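/- Let $(\mathcal V,g)$ be a spherically symmetric spacetime in advanced Eddington–Finkelstein form: $\mathcal V=D\times S^2$ with $D\subseteq\{(v,r): r>0\}$ open, and $$ds^2=-e^{2\beta}\Bigl(1-\frac{2m}{r}\Bigr)dv^2+2e^{\beta}\,dv\,dr+r^2d\Omega^2,$$ where $\beta=\beta(v,r)$ and $m=m(v,r)$ are $C^2$ functions on $D$, $d\Omega^2$ is the standard metric of the unit sphere, and the future is given by increasing $v$ (the future-directed radial null fields are $\ell=-e^{-\beta}\partial_r$ and $k=\partial_v+\tfrac12(1-\tfrac{2m}{r})e^{\beta}\partial_r$). Put $\mathscr R_0=\{r-2m>0\}$ (the region of untrapped round spheres), $\mathscr R=\{r-2m\ge 0\}$, $\mathrm{AH}=\{r-2m=0\}$ (the apparent 3-horizon) and $\mathrm{AH}^{iso}=\{x\in \mathrm{AH}: G_{\mu\nu}k^\mu k^\nu|_x=0\}$, where $G$ is the Einstein tensor of $g$. A closed future-trapped (f-trapped) sphere is the image of a $C^3$ embedding of $S^2$ into $\mathcal V$ with positive definite induced metric $\gamma_{AB}$ and with both future null expansions negative everywhere: $\theta^\pm=\gamma^{AB}K^\pm_{AB}<0$,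 where $K^{\pm}_{AB}=-g(k^\pm,\nabla_{e_A}e_B)$ and $k^\pm$ are the future-directed null normals with $g(k^+,k^-)=-1$. **Theorem.** Closed f-trapped spheres penetrate both sides of $\mathrm{AH}\setminus\mathrm{AH}^{iso}$, at every point of it, with arbitrarily small portions outside $\mathscr R$. Precisely: let $p\in \mathrm{AH}\setminus\mathrm{AH}^{iso}$, let $W$ be an open neighbourhood of the round sphere through $p$ (constant $v$ and $r$), let $U$ be an open neighbourhood of $p$, and let $\varepsilon>0$. Then there is a closed f-trapped sphere $S\subset W$ such that 1. $S\cap\mathscr R_0\neq\emptyset$ and $S\setminus\mathscr R\ne\emptyset$; 2. $S\cap \mathrm{AH}\subseteq \mathrm{AH}\setminus\mathrm{AH}^{iso}$; 3. $S\setminus\mathscr R\subseteq U$ and $\operatorname{area}(S\setminus\mathscr R)<\varepsilon\,\operatorname{area}(S)$, areas being taken in the induced metric. -/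

import Mathlib

open scoped Manifold
open MeasureTheory

noncomputable section

/-! ### Coordinate geometry on open subsets of `ℝ⁴` -/

/-- Points (and tangent vectors, in components) of `ℝ⁴`. -/
abbrev Pt : Type := Fin 4 → ℝ

/-- The partial derivative `∂_μ f` at `p`. -/
def pderiv (f : Pt → ℝ) (μ : Fin 4) (p : Pt) : ℝ := fderiv ℝ f p (Pi.single μ 1)

/-- A field of metric coefficients `g_{μν}`. -/
abbrev MetricField : Type := Pt → Matrix (Fin 4) (Fin 4) ℝ

namespace MetricField

/-- The scalar product `g_{μν} X^μ Y^ν` at `p`. -/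
def dot (g : MetricField) (p X Y : Pt) : ℝ := ∑ μ, ∑ ν, g p μ ν * X μ * Y ν

/-- The Christoffel symbols `Γ^μ_{νρ}` of the Levi-Civita connection. -/
def christoffel (g : MetricField) (p : Pt) (μ ν ρ : Fin 4) : ℝ :=
  (1 / 2) * ∑ σ, (g p)⁻¹ μ σ *
    (pderiv (fun x => g x σ ρ) ν p + pderiv (fun x => g x σ ν) ρ p
      - pderiv (fun x => g x ν ρ) σ p)

/-- The Ricci tensor
`R_{νρ} = ∂_μ Γ^μ_{νρ} - ∂_ν Γ^μ_{μρ} + Γ^μ_{μκ} Γ^κ_{νρ} - Γ^μ_{νκ} Γ^κ_{μρ}`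
(with this sign it is positive on round spheres). -/
def ricci (g : MetricField) (p : Pt) (ν ρ : Fin 4) : ℝ :=
  ∑ μ, (pderiv (fun x => g.christoffel x μ ν ρ) μ p
        - pderiv (fun x => g.christoffel x μ μ ρ) ν p)
    + ∑ μ, ∑ κ, (g.christoffel p μ μ κ * g.christoffel p κ ν ρ
        - g.christoffel p μ ν κ * g.christoffel p κ μ ρ)

/-- The scalar curvature. -/
def scalarCurvature (g : MetricField) (p : Pt) : ℝ :=
  ∑ μ, ∑ ν, (g p)⁻¹ μ ν * g.ricci p μ ν

/-- The Einstein tensor `G_{μν} = R_{μν} - (1/2) R g_{μν}`. -/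
def einstein (g : MetricField) (p : Pt) (μ ν : Fin 4) : ℝ :=
  g.ricci p μ ν - (1 / 2) * g.scalarCurvature p * g p μ ν

end MetricField

/-! ### Parametrized spheres -/

/-- The unit sphere of Euclidean `ℝ³`, a smooth surface. -/
abbrev S2 : Type := Metric.sphere (0 : EuclideanSpace ℝ (Fin 3)) 1

/-- The map `Φ` on the sphere, written in the local coordinates `λ^A` around `q`. -/
def localParam {F : Type*} (Φ : S2 → F) (q : S2) : EuclideanSpace ℝ (Fin 2) → F :=
  Φ ∘ (extChartAt (𝓡 2) q).symm

/-- The tangent vector `e_A = ∂Φ/∂λ^A` at `q`. -/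
def tangentVec {F : Type*} [NormedAddCommGroup F] [NormedSpace ℝ F] (Φ : S2 → F) (q : S2)
    (A : Fin 2) : F :=
  fderiv ℝ (localParam Φ q) (extChartAt (𝓡 2) q q) (EuclideanSpace.single A 1)

/-- The second derivatives `∂²Φ/∂λ^A∂λ^B` at `q`. -/
def secondDeriv {F : Type*} [NormedAddCommGroup F] [NormedSpace ℝ F] (Φ : S2 → F) (q : S2)
    (A B : Fin 2) : F :=
  fderiv ℝ (fun y => fderiv ℝ (localParam Φ q) y (EuclideanSpace.single B 1))
    (extChartAt (𝓡 2) q q) (EuclideanSpace.single A 1)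

/-- The Gram determinant, in the same local coordinates, of the standard round metric. -/
def roundGram (q : S2) : ℝ :=
  (Matrix.of fun A B : Fin 2 =>
    inner ℝ (tangentVec (fun x : S2 => (x : EuclideanSpace ℝ (Fin 3))) q A)
      (tangentVec (fun x : S2 => (x : EuclideanSpace ℝ (Fin 3))) q B)).det

namespace MetricField

/-- The first fundamental form `γ_{AB} = g(e_A, e_B)` at `q`. -/
def firstForm (g : MetricField) (Φ : S2 → Pt) (q : S2) : Matrix (Fin 2) (Fin 2) ℝ :=
  Matrix.of fun A B => g.dot (Φ q) (tangentVec Φ q A) (tangentVec Φ q B)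

/-- The covariant derivative `∇_{e_A} e_B` along the surface, at `q`:
its components are `∂_A ∂_B Φ^μ + Γ^μ_{νρ} e_A^ν e_B^ρ`. -/
def covDeriv (g : MetricField) (Φ : S2 → Pt) (q : S2) (A B : Fin 2) : Pt := fun μ =>
  secondDeriv Φ q A B μ
    + ∑ ν, ∑ ρ, g.christoffel (Φ q) μ ν ρ * tangentVec Φ q A ν * tangentVec Φ q B ρ

/-- The null second fundamental form `K_{AB} = -g(k, ∇_{e_A} e_B)` along the normal `k`. -/
def nullForm (g : MetricField) (Φ : S2 → Pt) (q : S2) (k : Pt) (A B : Fin 2) : ℝ :=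
  - g.dot (Φ q) k (g.covDeriv Φ q A B)

/-- The expansion `θ = γ^{AB} K_{AB}` at `q` along the normal `k`. -/
def expansion (g : MetricField) (Φ : S2 → Pt) (q : S2) (k : Pt) : ℝ :=
  ∑ A, ∑ B, (g.firstForm Φ q)⁻¹ A B * g.nullForm Φ q k A B

/-- The area, for the metric induced by `g`, of the part in `A` of the surface `Φ`. The area
element of the induced metric is `√(det γ / det γ_round)` times the area element of the unit
sphere, which is `volume.toSphere` (of total mass `4π`). -/
def area (g : MetricField) (Φ : S2 → Pt) (A : Set Pt) : ENNReal :=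
  ∫⁻ q in Φ ⁻¹' A, ENNReal.ofReal (Real.sqrt ((g.firstForm Φ q).det / roundGram q))
    ∂((volume : Measure (EuclideanSpace ℝ (Fin 3))).toSphere)

end MetricField

/-! ### Spherically symmetric spacetimes -/

/-- The area coordinate `r` of the point `(v, x₁, x₂, x₃)`, where `r = |x|`. -/
def areaRadius (p : Pt) : ℝ := Real.sqrt (p 1 ^ 2 + p 2 ^ 2 + p 3 ^ 2)

/-- The pair `(v, r)` of advanced Eddington-Finkelstein coordinates. -/
def vr (p : Pt) : ℝ × ℝ := (p 0, areaRadius p)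

/-- The components of the one-form `dv`. -/
def dv (μ : Fin 4) : ℝ := if μ = 0 then 1 else 0

/-- The components `(0, x / r)` of the one-form `dr`. -/
def dr (p : Pt) (μ : Fin 4) : ℝ := if μ = 0 then 0 else p μ / areaRadius p

/-- The components `(0, x / r)` of the vector field `∂_r` (at fixed `v` and `x / |x|`). -/
def radialVec (p : Pt) : Pt := fun μ => if μ = 0 then 0 else p μ / areaRadius p

/-- The components of `r² dΩ² = |dx|² - dr²`, where `dΩ²` is the standard metric of the unit
sphere pulled back by `x ↦ x / |x|`. -/
def sphereMetric (p : Pt) (μ ν : Fin 4) : ℝ :=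
  (if μ = ν ∧ μ ≠ 0 then 1 else 0) - dr p μ * dr p ν

/-- A spherically symmetric spacetime in advanced Eddington-Finkelstein coordinates: an open
set of values of `(v, r)` with `r > 0`, and the functions `β(v, r)` and `m(v, r)` on it. -/
structure SphericalSpacetime where
  /-- The range of the coordinates `(v, r)`. -/
  dom : Set (ℝ × ℝ)
  isOpen_dom : IsOpen dom
  pos_of_mem : ∀ z ∈ dom, 0 < z.2
  /-- The metric function `β`. -/
  β : ℝ × ℝ → ℝ
  /-- The mass function `m`. -/
  m : ℝ × ℝ → ℝ
  contDiffOn_β : ContDiffOn ℝ 2 β dom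
  contDiffOn_m : ContDiffOn ℝ 2 m dom

namespace SphericalSpacetime

variable (M : SphericalSpacetime)

/-- The underlying manifold `dom × S²`: the pair of `(v, r)` and the direction `ω` is
represented by the point `(v, r ω)` of `ℝ × (ℝ³ \ {0})`. -/
def carrier : Set Pt := {p | vr p ∈ M.dom}

/-- `1 - 2m/r`. -/
def radFactor (p : Pt) : ℝ := 1 - 2 * M.m (vr p) / areaRadius p

/-- The metric `ds² = -e^{2β} (1 - 2m/r) dv² + 2 e^β dv dr + r² dΩ²`. -/
def metric : MetricField := fun p => Matrix.of fun μ ν =>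
  -Real.exp (2 * M.β (vr p)) * M.radFactor p * (dv μ * dv ν)
    + Real.exp (M.β (vr p)) * (dv μ * dr p ν + dr p μ * dv ν)
    + sphereMetric p μ ν

/-- The future ingoing radial null vector field `ℓ = -e^{-β} ∂_r`. -/
def ell (p : Pt) : Pt := -(Real.exp (-M.β (vr p)) • radialVec p)

/-- The future outgoing radial null vector field `k = ∂_v + (1/2) (1 - 2m/r) e^β ∂_r`. -/
def kay (p : Pt) : Pt :=
  (Pi.single 0 1 : Pt) + ((1 / 2) * M.radFactor p * Real.exp (M.β (vr p))) • radialVec p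

/-- The time orientation is that of the timelike vector field `k + ℓ`, along which `v`
increases: a causal vector is future directed if its product with `k + ℓ` is negative. -/
def FutureDirected (p X : Pt) : Prop :=
  M.metric.dot p X X ≤ 0 ∧ M.metric.dot p X (M.kay p + M.ell p) < 0

/-- The region `ℛ₀ : r - 2m(v, r) > 0` of untrapped round spheres. -/
def regionR0 : Set Pt := {p | p ∈ M.carrier ∧ 0 < areaRadius p - 2 * M.m (vr p)}

/-- The region `ℛ : r - 2m(v, r) ≥ 0`. -/
def regionR : Set Pt := {p | p ∈ M.carrier ∧ 0 ≤ areaRadius p - 2 * M.m (vr p)}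

/-- The apparent 3-horizon `AH : r - 2m(v, r) = 0`. -/
def AH : Set Pt := {p | p ∈ M.carrier ∧ areaRadius p - 2 * M.m (vr p) = 0}

/-- The isolated-horizon portion of `AH`, where `G_{μν} k^μ k^ν = 0`. -/
def AHiso : Set Pt :=
  {p | p ∈ M.AH ∧ ∑ μ, ∑ ν, M.metric.einstein p μ ν * M.kay p μ * M.kay p ν = 0}

/-- `k` is a future-directed null vector at `Φ q`, normal to the surface `Φ`. -/
def IsFutureNullNormal (Φ : S2 → Pt) (q : S2) (k : Pt) : Prop :=
  M.FutureDirected (Φ q) k ∧ M.metric.dot (Φ q) k k = 0 ∧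
    ∀ A, M.metric.dot (Φ q) k (tangentVec Φ q A) = 0

/-- `Φ` is a closed future-trapped surface with the topology of a sphere: a `C³` spacelike
embedding of the sphere whose two future null expansions are negative everywhere. (The
embedding is an immersion because its first fundamental form is positive definite.) -/
structure IsFTrappedSphere (Φ : S2 → Pt) : Prop where
  contMDiff : ContMDiff (𝓡 2) 𝓘(ℝ, Pt) 3 Φ
  injective : Function.Injective Φ
  mem_carrier : ∀ q, Φ q ∈ M.carrier
  spacelike : ∀ q, (M.metric.firstForm Φ q).PosDef
  trapped : ∀ q, ∃ kp km : Pt,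
    M.IsFutureNullNormal Φ q kp ∧ M.IsFutureNullNormal Φ q km ∧
    M.metric.dot (Φ q) kp km = -1 ∧
    M.metric.expansion Φ q kp < 0 ∧ M.metric.expansion Φ q km < 0

end SphericalSpacetime

/-- The round sphere through `p`: the points with the same values of `v` and `r`. -/
def roundSphere (p : Pt) : Set Pt := {x | vr x = vr p}

end

/-!
The round sphere through a point `p` of the apparent horizon is marginally trapped: its outgoing
expansion vanishes and its ingoing expansion is negative. It is deformed to the graph
`v = v₀ + s a(t)`, `r = r₀ + s b(t)`, where `t = ⟨n, q⟩` is the height of the direction `q` along the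
axis `n` through `p`, and `s > 0` is small. To first order in `s`, the quantity `r - 2m` on the graph
is `s (∂_v (r - 2m) a + ∂_r (r - 2m) b)`, and the outgoing expansion is a positive multiple of
`(r - 2m) - s Δb`, where `Δ` is the Laplacian of the unit sphere.

Since `G(k, k) = 2 e^β (∂_v m) / r²` on the apparent horizon (`ricci_zero_zero_of_mem_AH`,
`mem_AHiso_iff`), the hypothesis on `p` says that `∂_v m ≠ 0` at `p`. Therefore `a` can be chosen, for
any given `b`, so that `r - 2m = s (Δb - 1/4) + o(s)`; the outgoing expansion is then negative for
small `s`. The graph lies outside `ℛ` where `Δb < 1/4` and inside `ℛ₀` where `Δb > 1/4`, up to an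
arbitrarily small error. As `Δb` need only have mean zero, it can be at least `1/2` off a small cap
around `n` and negative at `n`: this is `exists_profile`. The cap is chosen so small that the part of
the graph over it lies in `U` and has little area.

The work is in the passage from first order to small positive `s`. The Christoffel symbols are
computed in closed form (`christoffel_eq`), and the fundamental forms of the graph and its two null
normals are expressed by finitely many numbers (`GraphData`, `IsGraphAt`), on which the outgoing
null form, divided by `s`, depends polynomially. These numbers stay in a compact set, so the
inequalities that hold at `s = 0` hold uniformly for small `s` (`eventually_isTrappedAt`,
`eventually_isTrappedPoint`).
-/

open scoped Manifold
open MeasureTheory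

noncomputable section

/-! ### The functions `v` and `r` on `ℝ⁴` -/

lemma areaRadius_sq (p : Pt) : areaRadius p ^ 2 = p 1 ^ 2 + p 2 ^ 2 + p 3 ^ 2 :=
  Real.sq_sqrt (by positivity)

lemma sum_dr_sq {p : Pt} (hp : 0 < areaRadius p) :
    dr p 1 ^ 2 + dr p 2 ^ 2 + dr p 3 ^ 2 = 1 := by
  have h := areaRadius_sq p
  simp only [dr]
  simp only [Fin.isValue, one_ne_zero, ↓reduceIte, Fin.reduceEq]
  field_simp
  linarith

lemma hasFDerivAt_areaRadius {p : Pt} (hp : 0 < areaRadius p) :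
    HasFDerivAt areaRadius (∑ μ, dr p μ • (ContinuousLinearMap.proj μ : Pt →L[ℝ] ℝ)) p := by
  have hsq : p 1 ^ 2 + p 2 ^ 2 + p 3 ^ 2 ≠ 0 := by
    rw [← areaRadius_sq]; positivity
  have hcoord (μ : Fin 4) : HasFDerivAt (fun x : Pt => x μ ^ 2)
      ((2 * p μ) • (ContinuousLinearMap.proj μ : Pt →L[ℝ] ℝ)) p := by
    have := ((ContinuousLinearMap.proj μ : Pt →L[ℝ] ℝ).hasFDerivAt (x := p)).pow 2
    simpa using this
  have h := (((hcoord 1).add (hcoord 2)).add (hcoord 3)).sqrt hsq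
  refine h.congr_fderiv ?_
  ext x
  have hr : Real.sqrt (p 1 ^ 2 + p 2 ^ 2 + p 3 ^ 2) = areaRadius p := rfl
  simp only [Fin.sum_univ_four, dr]
  simp
  rw [hr]
  field_simp

lemma pderiv_areaRadius {p : Pt} (hp : 0 < areaRadius p) (μ : Fin 4) :
    pderiv areaRadius μ p = dr p μ := by
  rw [pderiv, (hasFDerivAt_areaRadius hp).fderiv]
  fin_cases μ <;> simp [Fin.sum_univ_four]

lemma hasFDerivAt_vr {p : Pt} (hp : 0 < areaRadius p) :
    HasFDerivAt vr ((ContinuousLinearMap.proj 0 : Pt →L[ℝ] ℝ).prod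
      (∑ μ, dr p μ • (ContinuousLinearMap.proj μ : Pt →L[ℝ] ℝ))) p :=
  ((ContinuousLinearMap.proj 0 : Pt →L[ℝ] ℝ).hasFDerivAt).prodMk (hasFDerivAt_areaRadius hp)

lemma continuous_vr : Continuous vr := by
  unfold vr areaRadius
  fun_prop

/-- The partial derivative `∂_v H` of a function of `(v, r)`. -/
def partialV (H : ℝ × ℝ → ℝ) (z : ℝ × ℝ) : ℝ := fderiv ℝ H z (1, 0)

/-- The partial derivative `∂_r H` of a function of `(v, r)`. -/
def partialR (H : ℝ × ℝ → ℝ) (z : ℝ × ℝ) : ℝ := fderiv ℝ H z (0, 1)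

lemma fderiv_eq_partials (H : ℝ × ℝ → ℝ) (z w : ℝ × ℝ) :
    fderiv ℝ H z w = partialV H z * w.1 + partialR H z * w.2 := by
  have : w = w.1 • ((1, 0) : ℝ × ℝ) + w.2 • ((0, 1) : ℝ × ℝ) := by ext <;> simp
  conv_lhs => rw [this]
  rw [map_add, map_smul, map_smul, partialV, partialR, smul_eq_mul, smul_eq_mul]
  ring

lemma differentiableAt_comp_vr {H : ℝ × ℝ → ℝ} {p : Pt} (hp : 0 < areaRadius p)
    (hH : DifferentiableAt ℝ H (vr p)) : DifferentiableAt ℝ (fun x => H (vr x)) p :=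
  hH.comp p (hasFDerivAt_vr hp).differentiableAt

lemma pderiv_comp_vr {H : ℝ × ℝ → ℝ} {p : Pt} (hp : 0 < areaRadius p)
    (hH : DifferentiableAt ℝ H (vr p)) (μ : Fin 4) :
    pderiv (fun x => H (vr x)) μ p
      = partialV H (vr p) * dv μ + partialR H (vr p) * dr p μ := by
  have h := hH.hasFDerivAt.comp p (hasFDerivAt_vr hp)
  have h2 : fderiv ℝ (fun x => H (vr x)) p = _ := h.fderiv
  rw [pderiv, h2, ContinuousLinearMap.comp_apply, fderiv_eq_partials]
  fin_cases μ <;> simp [Fin.sum_univ_four, dv]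

lemma differentiableAt_dr {p : Pt} (hp : 0 < areaRadius p) (ν : Fin 4) :
    DifferentiableAt ℝ (fun x => dr x ν) p := by
  unfold dr
  split_ifs
  · exact differentiableAt_const _
  · simp only [div_eq_mul_inv]
    exact (differentiableAt_apply ν p).fun_mul
      ((hasFDerivAt_areaRadius hp).differentiableAt.fun_inv hp.ne')

lemma pderiv_const (c : ℝ) (μ : Fin 4) (p : Pt) : pderiv (fun _ => c) μ p = 0 := by
  simp [pderiv]

lemma pderiv_add {f g : Pt → ℝ} {p : Pt} (hf : DifferentiableAt ℝ f p)
    (hg : DifferentiableAt ℝ g p) (μ : Fin 4) :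
    pderiv (fun x => f x + g x) μ p = pderiv f μ p + pderiv g μ p := by
  simp [pderiv, fderiv_fun_add hf hg]

lemma pderiv_mul {f g : Pt → ℝ} {p : Pt} (hf : DifferentiableAt ℝ f p)
    (hg : DifferentiableAt ℝ g p) (μ : Fin 4) :
    pderiv (fun x => f x * g x) μ p = f p * pderiv g μ p + pderiv f μ p * g p := by
  simp [pderiv, fderiv_fun_mul hf hg]; ring

lemma pderiv_dr {p : Pt} (hp : 0 < areaRadius p) (μ ν : Fin 4) :
    pderiv (fun x => dr x ν) μ p = sphereMetric p μ ν / areaRadius p := by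
  by_cases hν : ν = 0
  · subst hν
    simp only [pderiv, dr, sphereMetric]
    simp only [if_true]
    have : ¬ (μ = 0 ∧ μ ≠ 0) := by tauto
    simp [this]
  · have hprod : pderiv (fun x : Pt => dr x ν * areaRadius x) μ p = pderiv (fun x => x ν) μ p := by
      refine congrArg (fun L : Pt →L[ℝ] ℝ => L (Pi.single μ 1)) (Filter.EventuallyEq.fderiv_eq ?_)
      filter_upwards [(hasFDerivAt_areaRadius hp).continuousAt.eventually_ne hp.ne'] with x hx
      simp [dr, hν, hx]
    have hcoord : pderiv (fun x : Pt => x ν) μ p = if μ = ν then 1 else 0 := by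
      simp [pderiv, fderiv_apply, Pi.single_apply, eq_comm]
    rw [pderiv_mul (differentiableAt_dr hp ν) (hasFDerivAt_areaRadius hp).differentiableAt, hcoord,
      show pderiv (fun x => areaRadius x) μ p = dr p μ from pderiv_areaRadius hp μ] at hprod
    have hμ : (if μ = ν ∧ μ ≠ 0 then (1 : ℝ) else 0) = if μ = ν then 1 else 0 := by
      by_cases h : μ = ν <;> simp [h, hν]
    rw [eq_div_iff hp.ne', sphereMetric, hμ]
    linarith

lemma sphereMetric_symm (p : Pt) (μ ν : Fin 4) : sphereMetric p μ ν = sphereMetric p ν μ := by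
  unfold sphereMetric
  by_cases h : μ = ν
  · subst h; rfl
  · simp [h, Ne.symm h]; ring

lemma differentiableAt_sphereMetric {p : Pt} (hp : 0 < areaRadius p) (μ ν : Fin 4) :
    DifferentiableAt ℝ (fun x => sphereMetric x μ ν) p :=
  (differentiableAt_const _).sub ((differentiableAt_dr hp μ).mul (differentiableAt_dr hp ν))

lemma pderiv_sphereMetric {p : Pt} (hp : 0 < areaRadius p) (σ μ ν : Fin 4) :
    pderiv (fun x => sphereMetric x μ ν) σ p
      = -(sphereMetric p σ μ * dr p ν + dr p μ * sphereMetric p σ ν) / areaRadius p := by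
  have h : pderiv (fun x => dr x μ * dr x ν) σ p = _ :=
    pderiv_mul (differentiableAt_dr hp μ) (differentiableAt_dr hp ν) σ
  rw [pderiv_dr hp, pderiv_dr hp] at h
  have h2 : pderiv (fun x => sphereMetric x μ ν) σ p = - pderiv (fun x => dr x μ * dr x ν) σ p := by
    simp only [pderiv, sphereMetric]
    rw [fderiv_const_sub]; rfl
  rw [h2, h]; ring

/-! ### The Levi-Civita connection of a spherically symmetric metric -/

namespace SphericalSpacetime

variable (M : SphericalSpacetime)

/-- The function `1 - 2m/r` of `(v, r)`. -/
def warp (z : ℝ × ℝ) : ℝ := 1 - 2 * M.m z / z.2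

/-- The negative of the Christoffel symbol `Γ^r_{vr}`. -/
def coefQ (z : ℝ × ℝ) : ℝ :=
  (1 / 2) * Real.exp (M.β z) * (2 * partialR M.β z * M.warp z + partialR M.warp z)

/-- The Christoffel symbol `Γ^v_{vv}`. -/
def coefG (z : ℝ × ℝ) : ℝ := partialV M.β z + M.coefQ z

/-- The Christoffel symbol `Γ^r_{vv}`. -/
def coefA (z : ℝ × ℝ) : ℝ :=
  -(1 / 2) * Real.exp (M.β z) * partialV M.warp z + Real.exp (M.β z) * M.warp z * M.coefQ z

variable {M}

lemma areaRadius_pos {p : Pt} (hp : p ∈ M.carrier) : 0 < areaRadius p := M.pos_of_mem _ hp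

lemma contDiffAt_β {z : ℝ × ℝ} (hz : z ∈ M.dom) : ContDiffAt ℝ 2 M.β z :=
  M.contDiffOn_β.contDiffAt (M.isOpen_dom.mem_nhds hz)

lemma contDiffAt_m {z : ℝ × ℝ} (hz : z ∈ M.dom) : ContDiffAt ℝ 2 M.m z :=
  M.contDiffOn_m.contDiffAt (M.isOpen_dom.mem_nhds hz)

lemma contDiffAt_warp {z : ℝ × ℝ} (hz : z ∈ M.dom) : ContDiffAt ℝ 2 M.warp z :=
  contDiffAt_const.sub ((contDiffAt_const.mul (contDiffAt_m hz)).div contDiffAt_snd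
    (M.pos_of_mem z hz).ne')

lemma contDiffAt_partialV {H : ℝ × ℝ → ℝ} {z : ℝ × ℝ} (hH : ContDiffAt ℝ 2 H z) :
    ContDiffAt ℝ 1 (partialV H) z :=
  (hH.fderiv_right (m := 1) (by norm_num)).clm_apply contDiffAt_const

lemma contDiffAt_partialR {H : ℝ × ℝ → ℝ} {z : ℝ × ℝ} (hH : ContDiffAt ℝ 2 H z) :
    ContDiffAt ℝ 1 (partialR H) z :=
  (hH.fderiv_right (m := 1) (by norm_num)).clm_apply contDiffAt_const

lemma contDiffAt_exp_β {z : ℝ × ℝ} (hz : z ∈ M.dom) :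
    ContDiffAt ℝ 2 (fun z => Real.exp (M.β z)) z := (contDiffAt_β hz).exp

lemma contDiffAt_coefQ {z : ℝ × ℝ} (hz : z ∈ M.dom) : ContDiffAt ℝ 1 M.coefQ z := by
  have h1 := (contDiffAt_exp_β hz).of_le (show (1 : WithTop ℕ∞) ≤ 2 by norm_num)
  have h2 := (contDiffAt_warp hz).of_le (show (1 : WithTop ℕ∞) ≤ 2 by norm_num)
  exact (contDiffAt_const.mul h1).mul
    (((contDiffAt_const.mul (contDiffAt_partialR (contDiffAt_β hz))).mul h2).add
      (contDiffAt_partialR (contDiffAt_warp hz)))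

lemma contDiffAt_coefG {z : ℝ × ℝ} (hz : z ∈ M.dom) : ContDiffAt ℝ 1 M.coefG z :=
  (contDiffAt_partialV (contDiffAt_β hz)).add (contDiffAt_coefQ hz)

lemma contDiffAt_coefA {z : ℝ × ℝ} (hz : z ∈ M.dom) : ContDiffAt ℝ 1 M.coefA z := by
  have h1 := (contDiffAt_exp_β hz).of_le (show (1 : WithTop ℕ∞) ≤ 2 by norm_num)
  have h2 := (contDiffAt_warp hz).of_le (show (1 : WithTop ℕ∞) ≤ 2 by norm_num)
  exact ((contDiffAt_const.mul h1).mul (contDiffAt_partialV (contDiffAt_warp hz))).add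
    ((h1.mul h2).mul (contDiffAt_coefQ hz))

lemma metric_apply (p : Pt) (μ ν : Fin 4) :
    M.metric p μ ν = -(Real.exp (M.β (vr p)) ^ 2 * M.warp (vr p)) * (dv μ * dv ν)
      + Real.exp (M.β (vr p)) * (dv μ * dr p ν + dr p μ * dv ν) + sphereMetric p μ ν := by
  have h : Real.exp (2 * M.β (vr p)) = Real.exp (M.β (vr p)) ^ 2 := by
    rw [← Real.exp_nat_mul]; norm_num
  have hw : M.radFactor p = M.warp (vr p) := rfl
  simp only [metric, Matrix.of_apply, h, hw]
  ring

lemma metric_inv {p : Pt} (hp : p ∈ M.carrier) :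
    (M.metric p)⁻¹ = Matrix.of fun μ ν =>
      (Real.exp (M.β (vr p)))⁻¹ * (dv μ * dr p ν + dr p μ * dv ν)
        + M.warp (vr p) * dr p μ * dr p ν + sphereMetric p μ ν := by
  have hn := sum_dr_sq (areaRadius_pos hp)
  have hE : Real.exp (M.β (vr p)) * (Real.exp (M.β (vr p)))⁻¹ = 1 :=
    mul_inv_cancel₀ (Real.exp_pos _).ne'
  apply Matrix.inv_eq_right_inv
  ext μ ν
  rw [Matrix.mul_apply]
  simp only [Fin.sum_univ_four, metric_apply, Matrix.of_apply, sphereMetric]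
  have hd0 : dr p 0 = 0 := by simp [dr]
  generalize (Real.exp (M.β (vr p)))⁻¹ = Ei at *
  generalize Real.exp (M.β (vr p)) = E at *
  generalize M.warp (vr p) = f at *
  generalize ha : dr p 1 = a at *
  generalize hb : dr p 2 = b at *
  generalize hc : dr p 3 = c at *
  fin_cases μ <;> fin_cases ν <;> simp [dv, hd0, ha, hb, hc] <;> grind

lemma pderiv_metric {p : Pt} (hp : p ∈ M.carrier) (σ μ ν : Fin 4) :
    pderiv (fun x => M.metric x μ ν) σ p =
      -Real.exp (M.β (vr p)) ^ 2 *
        ((2 * partialV M.β (vr p) * M.warp (vr p) + partialV M.warp (vr p)) * dv σ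
          + (2 * partialR M.β (vr p) * M.warp (vr p) + partialR M.warp (vr p)) * dr p σ)
        * (dv μ * dv ν)
      + Real.exp (M.β (vr p)) * (partialV M.β (vr p) * dv σ + partialR M.β (vr p) * dr p σ)
        * (dv μ * dr p ν + dr p μ * dv ν)
      + Real.exp (M.β (vr p)) * (dv μ * sphereMetric p σ ν + sphereMetric p σ μ * dv ν)
        / areaRadius p
      - (sphereMetric p σ μ * dr p ν + dr p μ * sphereMetric p σ ν) / areaRadius p := by
  have hr := areaRadius_pos hp
  have hβ : DifferentiableAt ℝ M.β (vr p) := (contDiffAt_β hp).differentiableAt (by norm_num)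
  have hw : DifferentiableAt ℝ M.warp (vr p) := (contDiffAt_warp hp).differentiableAt (by norm_num)
  have hβ' := differentiableAt_comp_vr hr hβ
  have hw' := differentiableAt_comp_vr hr hw
  have hE' : DifferentiableAt ℝ (fun x => Real.exp (M.β (vr x))) p := hβ'.exp
  have hEd (τ : Fin 4) : pderiv (fun x => Real.exp (M.β (vr x))) τ p
      = Real.exp (M.β (vr p)) * (partialV M.β (vr p) * dv τ + partialR M.β (vr p) * dr p τ) := by
    rw [← pderiv_comp_vr hr hβ]
    simp [pderiv, fderiv_exp hβ']
  have hfun : (fun x => M.metric x μ ν) = fun x =>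
      ((-(dv μ * dv ν)) * (Real.exp (M.β (vr x)) * (Real.exp (M.β (vr x)) * M.warp (vr x)))
      + Real.exp (M.β (vr x)) * (dv μ * dr x ν + dr x μ * dv ν)) + sphereMetric x μ ν := by
    funext x; rw [metric_apply]; ring
  have d1 := hE'.fun_mul (hE'.fun_mul hw')
  have dn := differentiableAt_dr hr
  have c (a : ℝ) : DifferentiableAt ℝ (fun _ : Pt => a) p := differentiableAt_const a
  have d2 : DifferentiableAt ℝ (fun x => dv μ * dr x ν + dr x μ * dv ν) p :=
    ((c _).fun_mul (dn ν)).fun_add ((dn μ).fun_mul (c _))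
  rw [hfun, pderiv_add (((c _).fun_mul d1).fun_add (hE'.fun_mul d2)) (differentiableAt_sphereMetric hr μ ν),
    pderiv_add ((c _).fun_mul d1) (hE'.fun_mul d2), pderiv_mul (c _) d1, pderiv_mul hE' (hE'.fun_mul hw'),
    pderiv_mul hE' hw', pderiv_mul hE' d2, pderiv_add ((c _).fun_mul (dn ν)) ((dn μ).fun_mul (c _)),
    pderiv_mul (c _) (dn ν), pderiv_mul (dn μ) (c _), pderiv_sphereMetric hr, hEd,
    pderiv_comp_vr hr hw, pderiv_dr hr, pderiv_dr hr, pderiv_const, pderiv_const, pderiv_const]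
  ring

/-- The Christoffel symbols in closed form. Here `dr p μ` also serves as the components of `∂_r`,
which agree with those of `dr` in these coordinates. -/
lemma christoffel_eq {p : Pt} (hp : p ∈ M.carrier) (μ ν ρ : Fin 4) :
    M.metric.christoffel p μ ν ρ =
      dv μ * (M.coefG (vr p) * dv ν * dv ρ
        - (Real.exp (M.β (vr p)))⁻¹ * sphereMetric p ν ρ / areaRadius p)
      + dr p μ * (M.coefA (vr p) * dv ν * dv ρ
        - M.coefQ (vr p) * (dv ν * dr p ρ + dr p ν * dv ρ)
        + partialR M.β (vr p) * dr p ν * dr p ρ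
        + (1 - M.warp (vr p)) * sphereMetric p ν ρ / areaRadius p) := by
  have hn := sum_dr_sq (areaRadius_pos hp)
  have hd0 : dr p 0 = 0 := by simp [dr]
  have hE : Real.exp (M.β (vr p)) * (Real.exp (M.β (vr p)))⁻¹ = 1 :=
    mul_inv_cancel₀ (Real.exp_pos _).ne'
  set E := Real.exp (M.β (vr p)) with hEdef
  set f := M.warp (vr p) with hf
  -- the symbols of the first kind are combinations of `dv` and `dr` in their first index
  have hlow (σ : Fin 4) : pderiv (fun x => M.metric x σ ρ) ν p
      + pderiv (fun x => M.metric x σ ν) ρ p - pderiv (fun x => M.metric x ν ρ) σ p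
      = dv σ * (-E ^ 2 * ((2 * partialV M.β (vr p) * f + partialV M.warp (vr p)) * dv ν * dv ρ
          + (2 * partialR M.β (vr p) * f + partialR M.warp (vr p))
            * (dr p ν * dv ρ + dv ν * dr p ρ))
          + 2 * E * (partialR M.β (vr p) * dr p ν * dr p ρ + sphereMetric p ν ρ / areaRadius p))
        + dr p σ * (2 * E * partialV M.β (vr p) * dv ν * dv ρ
          + E ^ 2 * (2 * partialR M.β (vr p) * f + partialR M.warp (vr p)) * dv ν * dv ρ
          - 2 * sphereMetric p ν ρ / areaRadius p) := by
    rw [pderiv_metric hp, pderiv_metric hp, pderiv_metric hp, sphereMetric_symm p ρ ν,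
      sphereMetric_symm p σ ν, sphereMetric_symm p σ ρ]
    simp only [← hEdef, ← hf]
    ring
  have hraise (a b : ℝ) : ∑ σ, (M.metric p)⁻¹ μ σ * (dv σ * a + dr p σ * b)
      = E⁻¹ * dr p μ * a + (E⁻¹ * dv μ + f * dr p μ) * b := by
    rw [metric_inv hp]
    simp only [Fin.sum_univ_four, Matrix.of_apply, sphereMetric, ← hEdef, ← hf]
    clear hlow
    generalize E⁻¹ = Ei at *
    clear_value E f
    generalize ha : dr p 1 = x at *
    generalize hb : dr p 2 = y at *
    generalize hc : dr p 3 = z at *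
    fin_cases μ <;> simp [dv, hd0, ha, hb, hc] <;> grind
  rw [MetricField.christoffel]
  simp only [hlow]
  rw [hraise, coefG, coefA, coefQ]
  simp only [← hEdef, ← hf]
  have hE0 : E ≠ 0 := (Real.exp_pos _).ne'
  field_simp
  ring

end SphericalSpacetime

/-! ### The isolated part of the apparent horizon -/

namespace SphericalSpacetime

variable {M : SphericalSpacetime}

lemma isOpen_carrier : IsOpen M.carrier := M.isOpen_dom.preimage continuous_vr

lemma dr_zero (p : Pt) : dr p 0 = 0 := by simp [dr]

lemma sphereMetric_zero_left (p : Pt) (ν : Fin 4) : sphereMetric p 0 ν = 0 := by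
  have : ¬ ((0 : Fin 4) = ν ∧ (0 : Fin 4) ≠ 0) := by tauto
  simp [sphereMetric, dr]

lemma sphereMetric_zero_right (p : Pt) (ν : Fin 4) : sphereMetric p ν 0 = 0 := by
  rw [sphereMetric_symm, sphereMetric_zero_left]

lemma pderiv_congr {f g : Pt → ℝ} {p : Pt} (h : f =ᶠ[nhds p] g) (μ : Fin 4) :
    pderiv f μ p = pderiv g μ p := by
  rw [pderiv, h.fderiv_eq, pderiv]

lemma pderiv_christoffel_zero_zero {p : Pt} (hp : p ∈ M.carrier) (μ : Fin 4) :
    pderiv (fun x => M.metric.christoffel x μ 0 0) μ p =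
      dv μ * partialV M.coefG (vr p) + sphereMetric p μ μ / areaRadius p * M.coefA (vr p)
        + dr p μ ^ 2 * partialR M.coefA (vr p) := by
  have hr := areaRadius_pos hp
  have h : (fun x => M.metric.christoffel x μ 0 0) =ᶠ[nhds p]
      fun x => dv μ * M.coefG (vr x) + dr x μ * M.coefA (vr x) := by
    filter_upwards [isOpen_carrier.mem_nhds hp] with x hx
    rw [christoffel_eq hx]
    simp [dr_zero, sphereMetric_zero_left, dv]
  have hG := (contDiffAt_coefG hp).differentiableAt one_ne_zero
  have hA := (contDiffAt_coefA hp).differentiableAt one_ne_zero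
  have hG' := differentiableAt_comp_vr hr hG
  have hA' := differentiableAt_comp_vr hr hA
  have c (a : ℝ) : DifferentiableAt ℝ (fun _ : Pt => a) p := differentiableAt_const a
  rw [pderiv_congr h, pderiv_add ((c _).fun_mul hG') ((differentiableAt_dr hr μ).fun_mul hA'),
    pderiv_mul (c _) hG', pderiv_mul (differentiableAt_dr hr μ) hA', pderiv_const,
    pderiv_comp_vr hr hG, pderiv_comp_vr hr hA, pderiv_dr hr]
  by_cases h0 : μ = 0
  · subst h0; simp [dv, dr_zero]
  · simp [dv, h0]; ring

lemma pderiv_christoffel_trace {p : Pt} (hp : p ∈ M.carrier) (μ : Fin 4) :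
    pderiv (fun x => M.metric.christoffel x μ μ 0) 0 p =
      dv μ * partialV M.coefG (vr p) - dr p μ ^ 2 * partialV M.coefQ (vr p) := by
  have hr := areaRadius_pos hp
  have h : (fun x => M.metric.christoffel x μ μ 0) =ᶠ[nhds p]
      fun x => dv μ * M.coefG (vr x) + dr x μ * dr x μ * (-1 * M.coefQ (vr x)) := by
    filter_upwards [isOpen_carrier.mem_nhds hp] with x hx
    rw [christoffel_eq hx]
    by_cases h0 : μ = 0
    · subst h0; simp [dr_zero, sphereMetric_zero_left, dv]
    · simp [dr_zero, sphereMetric_zero_right, dv, h0]; ring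
  have hG := (contDiffAt_coefG hp).differentiableAt one_ne_zero
  have hQ := (contDiffAt_coefQ hp).differentiableAt one_ne_zero
  have hG' := differentiableAt_comp_vr hr hG
  have hQ' := differentiableAt_comp_vr hr hQ
  have c (a : ℝ) : DifferentiableAt ℝ (fun _ : Pt => a) p := differentiableAt_const a
  have hn := differentiableAt_dr hr μ
  rw [pderiv_congr h, pderiv_add ((c _).fun_mul hG') ((hn.fun_mul hn).fun_mul ((c _).fun_mul hQ')),
    pderiv_mul (c _) hG', pderiv_mul (hn.fun_mul hn) ((c _).fun_mul hQ'), pderiv_mul hn hn,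
    pderiv_mul (c _) hQ', pderiv_const, pderiv_const,
    pderiv_comp_vr hr hG, pderiv_comp_vr hr hQ, pderiv_dr hr, sphereMetric_zero_left]
  simp [dr_zero, dv]
  ring

/-- The component `R_{vv}` of the Ricci tensor, before the horizon condition is used. -/
lemma ricci_zero_zero {p : Pt} (hp : p ∈ M.carrier) :
    M.metric.ricci p 0 0 = partialV M.coefQ (vr p) + partialR M.coefA (vr p)
      + 2 / areaRadius p * M.coefA (vr p) + partialR M.β (vr p) * M.coefA (vr p)
      - partialV M.β (vr p) * M.coefQ (vr p) - 2 * M.coefQ (vr p) ^ 2 := by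
  have hn := sum_dr_sq (areaRadius_pos hp)
  have hn1 : dr p 1 ^ 2 = 1 - dr p 2 ^ 2 - dr p 3 ^ 2 := by linarith
  have hr := areaRadius_pos hp
  simp only [MetricField.ricci, Finset.sum_sub_distrib, pderiv_christoffel_zero_zero hp,
    pderiv_christoffel_trace hp, christoffel_eq hp, Fin.sum_univ_four]
  simp only [sphereMetric]
  simp [dr_zero, dv]
  simp only [coefG]
  generalize partialV M.coefQ (vr p) = Qv at *
  generalize partialR M.coefA (vr p) = Ar at *
  generalize M.coefA (vr p) = A at *
  generalize M.coefQ (vr p) = Q at *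
  generalize partialR M.β (vr p) = br at *
  generalize partialV M.β (vr p) = bv at *
  generalize (Real.exp (M.β (vr p)))⁻¹ = Ei at *
  generalize M.warp (vr p) = f at *
  generalize dr p 1 = x at *
  generalize dr p 2 = y at *
  generalize dr p 3 = z at *
  generalize areaRadius p = r at *
  simp only [div_eq_mul_inv]
  generalize r⁻¹ = ri at *
  clear hr
  grind

lemma partialV_mul {f g : ℝ × ℝ → ℝ} {z : ℝ × ℝ} (hf : DifferentiableAt ℝ f z)
    (hg : DifferentiableAt ℝ g z) :
    partialV (fun x => f x * g x) z = f z * partialV g z + partialV f z * g z := by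
  simp [partialV, fderiv_fun_mul hf hg]; ring

lemma partialR_mul {f g : ℝ × ℝ → ℝ} {z : ℝ × ℝ} (hf : DifferentiableAt ℝ f z)
    (hg : DifferentiableAt ℝ g z) :
    partialR (fun x => f x * g x) z = f z * partialR g z + partialR f z * g z := by
  simp [partialR, fderiv_fun_mul hf hg]; ring

lemma partialV_add {f g : ℝ × ℝ → ℝ} {z : ℝ × ℝ} (hf : DifferentiableAt ℝ f z)
    (hg : DifferentiableAt ℝ g z) :
    partialV (fun x => f x + g x) z = partialV f z + partialV g z := by
  simp [partialV, fderiv_fun_add hf hg]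

lemma partialR_add {f g : ℝ × ℝ → ℝ} {z : ℝ × ℝ} (hf : DifferentiableAt ℝ f z)
    (hg : DifferentiableAt ℝ g z) :
    partialR (fun x => f x + g x) z = partialR f z + partialR g z := by
  simp [partialR, fderiv_fun_add hf hg]

lemma partialV_const_mul {f : ℝ × ℝ → ℝ} {z : ℝ × ℝ} (hf : DifferentiableAt ℝ f z) (c : ℝ) :
    partialV (fun x => c * f x) z = c * partialV f z := by
  simp [partialV, fderiv_const_mul hf]

lemma partialR_const_mul {f : ℝ × ℝ → ℝ} {z : ℝ × ℝ} (hf : DifferentiableAt ℝ f z) (c : ℝ) :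
    partialR (fun x => c * f x) z = c * partialR f z := by
  simp [partialR, fderiv_const_mul hf]

lemma partialV_exp {f : ℝ × ℝ → ℝ} {z : ℝ × ℝ} (hf : DifferentiableAt ℝ f z) :
    partialV (fun x => Real.exp (f x)) z = Real.exp (f z) * partialV f z := by
  simp [partialV, fderiv_exp hf]

lemma partialR_exp {f : ℝ × ℝ → ℝ} {z : ℝ × ℝ} (hf : DifferentiableAt ℝ f z) :
    partialR (fun x => Real.exp (f x)) z = Real.exp (f z) * partialR f z := by
  simp [partialR, fderiv_exp hf]

lemma partialV_partialR_comm {H : ℝ × ℝ → ℝ} {z : ℝ × ℝ} (hH : ContDiffAt ℝ 2 H z) :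
    partialV (partialR H) z = partialR (partialV H) z := by
  have hd : DifferentiableAt ℝ (fderiv ℝ H) z :=
    (hH.fderiv_right (m := 1) (by norm_num)).differentiableAt one_ne_zero
  have h (u w : ℝ × ℝ) : fderiv ℝ (fun x => fderiv ℝ H x u) z w = fderiv ℝ (fderiv ℝ H) z w u := by
    rw [fderiv_clm_apply hd (differentiableAt_const u)]
    simp
  have hsymm : IsSymmSndFDerivAt ℝ H z := hH.isSymmSndFDerivAt (by simp)
  change fderiv ℝ (fun x => fderiv ℝ H x (0, 1)) z (1, 0)
    = fderiv ℝ (fun x => fderiv ℝ H x (1, 0)) z (0, 1)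
  rw [h, h, hsymm]

lemma partialV_warp {z : ℝ × ℝ} (hz : z ∈ M.dom) :
    partialV M.warp z = -2 * partialV M.m z / z.2 := by
  have hr := M.pos_of_mem z hz
  have hm : DifferentiableAt ℝ M.m z := (contDiffAt_m hz).differentiableAt (by norm_num)
  have hd : DifferentiableAt ℝ (fun x : ℝ × ℝ => (x.2)⁻¹) z :=
    differentiableAt_snd.fun_inv hr.ne'
  have hinv : partialV (fun x : ℝ × ℝ => (x.2)⁻¹) z = 0 := by
    have h1 : HasFDerivAt (fun x : ℝ × ℝ => x.2) (ContinuousLinearMap.snd ℝ ℝ ℝ) z :=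
      hasFDerivAt_snd
    have h2 := (hasDerivAt_inv hr.ne').hasFDerivAt.comp z h1
    have h3 : fderiv ℝ (fun x : ℝ × ℝ => (x.2)⁻¹) z = _ := h2.fderiv
    rw [partialV, h3]
    simp
  have h : M.warp = fun x => 1 + -2 * (M.m x * (x.2)⁻¹) := by
    funext x; rw [warp]; ring
  rw [h, partialV_add (differentiableAt_const _) ((hm.fun_mul hd).const_mul _),
    partialV_const_mul (hm.fun_mul hd), partialV_mul hm hd, hinv]
  simp [partialV]
  ring

/-- On the apparent horizon the only curvature left in `R_{vv}` is the growth rate of the mass. -/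
lemma ricci_zero_zero_of_mem_AH {p : Pt} (hp : p ∈ M.AH) :
    M.metric.ricci p 0 0
      = 2 * Real.exp (M.β (vr p)) * partialV M.m (vr p) / areaRadius p ^ 2 := by
  obtain ⟨hc, hA⟩ := hp
  have hr := areaRadius_pos hc
  have hf : M.warp (vr p) = 0 := by
    have : 2 * M.m (vr p) = areaRadius p := by linarith
    simp [warp, vr] at this ⊢
    rw [this, div_self hr.ne', sub_self]
  have hβ : DifferentiableAt ℝ M.β (vr p) := (contDiffAt_β hc).differentiableAt (by norm_num)
  have hw : DifferentiableAt ℝ M.warp (vr p) := (contDiffAt_warp hc).differentiableAt (by norm_num)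
  have hE : DifferentiableAt ℝ (fun z => Real.exp (M.β z)) (vr p) := hβ.exp
  have hβr := (contDiffAt_partialR (contDiffAt_β hc)).differentiableAt one_ne_zero
  have hwr := (contDiffAt_partialR (contDiffAt_warp hc)).differentiableAt one_ne_zero
  have hwv := (contDiffAt_partialV (contDiffAt_warp hc)).differentiableAt one_ne_zero
  have hQ := (contDiffAt_coefQ hc).differentiableAt one_ne_zero
  have hQfun : M.coefQ = fun z => (1 / 2) * (Real.exp (M.β z) *
      (2 * (partialR M.β z * M.warp z) + partialR M.warp z)) := by
    funext z; rw [coefQ]; ring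
  have hAfun : M.coefA = fun z => (-(1 / 2)) * (Real.exp (M.β z) * partialV M.warp z)
      + Real.exp (M.β z) * (M.warp z * M.coefQ z) := by
    funext z; rw [coefA]; ring
  have hQv : partialV M.coefQ (vr p) = (1 / 2) * Real.exp (M.β (vr p)) *
      (partialV M.β (vr p) * partialR M.warp (vr p)
        + 2 * partialR M.β (vr p) * partialV M.warp (vr p)
        + partialV (partialR M.warp) (vr p)) := by
    have h2 := (hβr.fun_mul hw).const_mul 2
    rw [hQfun, partialV_const_mul (hE.fun_mul (h2.fun_add hwr)),
      partialV_mul hE (h2.fun_add hwr), partialV_add h2 hwr, partialV_const_mul (hβr.fun_mul hw),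
      partialV_mul hβr hw, partialV_exp hβ, hf]
    ring
  have hAr : partialR M.coefA (vr p) = -(1 / 2) * Real.exp (M.β (vr p)) *
      (partialR M.β (vr p) * partialV M.warp (vr p) + partialR (partialV M.warp) (vr p))
        + Real.exp (M.β (vr p)) * partialR M.warp (vr p) * M.coefQ (vr p) := by
    rw [hAfun, partialR_add ((hE.fun_mul hwv).const_mul _) (hE.fun_mul (hw.fun_mul hQ)),
      partialR_const_mul (hE.fun_mul hwv), partialR_mul hE hwv,
      partialR_mul hE (hw.fun_mul hQ), partialR_mul hw hQ, partialR_exp hβ, hf]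
    ring
  have hQ0 : M.coefQ (vr p) = (1 / 2) * Real.exp (M.β (vr p)) * partialR M.warp (vr p) := by
    rw [coefQ, hf]; ring
  have hA0 : M.coefA (vr p) = -(1 / 2) * Real.exp (M.β (vr p)) * partialV M.warp (vr p) := by
    rw [coefA, hf]; ring
  rw [ricci_zero_zero hc, hQv, hAr, hQ0, hA0, partialV_partialR_comm (contDiffAt_warp hc),
    partialV_warp hc]
  simp only [vr]
  field_simp
  ring

/-- On the apparent horizon `k = ∂_v` and `g_{vv} = 0`, so `G(k, k)` is `R_{vv}`. -/
lemma mem_AHiso_iff {p : Pt} (hp : p ∈ M.AH) : p ∈ M.AHiso ↔ partialV M.m (vr p) = 0 := by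
  have hc := hp.1
  have hr := areaRadius_pos hc
  have hf : M.radFactor p = 0 := by
    have : 2 * M.m (vr p) = areaRadius p := by linarith [hp.2]
    rw [radFactor, this, div_self hr.ne', sub_self]
  have hg : M.metric p 0 0 = 0 := by
    have hw : M.warp (vr p) = 0 := hf
    rw [metric_apply, hw, sphereMetric_zero_left, dr_zero]
    ring
  have hsum : ∑ μ, ∑ ν, M.metric.einstein p μ ν * M.kay p μ * M.kay p ν
      = M.metric.ricci p 0 0 := by
    simp [Fin.sum_univ_four, kay, hf, MetricField.einstein, hg]
  rw [AHiso, Set.mem_ofPred_eq, hsum, ricci_zero_zero_of_mem_AH hp]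
  have hE := Real.exp_pos (M.β (vr p))
  constructor
  · rintro ⟨-, h⟩
    have : 2 * Real.exp (M.β (vr p)) * partialV M.m (vr p) = 0 := by
      rcases div_eq_zero_iff.mp h with h | h
      · exact h
      · exact absurd h (by positivity)
    rcases mul_eq_zero.mp this with h | h
    · exact absurd h (by positivity)
    · exact h
  · intro h
    exact ⟨hp, by rw [h]; simp⟩
end SphericalSpacetime

/-! ### Second-order jets in the charts of the sphere -/

/-- The coordinate plane of the charts of the sphere. -/
abbrev Plane : Type := EuclideanSpace ℝ (Fin 2)

/-- The function `u` on the coordinate plane is `C²` at the origin, with first derivatives `u₁ A`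
and second derivatives `u₂ A B` there. -/
structure HasJet (u : Plane → ℝ) (u₁ : Fin 2 → ℝ) (u₂ : Fin 2 → Fin 2 → ℝ) : Prop where
  contDiffAt : ContDiffAt ℝ 2 u 0
  first : ∀ A, fderiv ℝ u 0 (EuclideanSpace.single A 1) = u₁ A
  second : ∀ A B, fderiv ℝ (fun y => fderiv ℝ u y (EuclideanSpace.single B 1)) 0
    (EuclideanSpace.single A 1) = u₂ A B

namespace HasJet

variable {u w : Plane → ℝ} {u₁ w₁ : Fin 2 → ℝ} {u₂ w₂ : Fin 2 → Fin 2 → ℝ}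

lemma differentiableAt (hu : HasJet u u₁ u₂) : DifferentiableAt ℝ u 0 :=
  hu.contDiffAt.differentiableAt (by norm_num)

lemma eventually_differentiableAt (hu : HasJet u u₁ u₂) :
    ∀ᶠ y in nhds 0, DifferentiableAt ℝ u y := by
  filter_upwards [hu.contDiffAt.eventually (by norm_num)] with y hy
  exact hy.differentiableAt (by norm_num)

lemma differentiableAt_fderiv (hu : HasJet u u₁ u₂) (v : Plane) :
    DifferentiableAt ℝ (fun y => fderiv ℝ u y v) 0 :=
  ((hu.contDiffAt.fderiv_right (m := 1) (by norm_num)).differentiableAt one_ne_zero).clm_apply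
    (differentiableAt_const v)

lemma congr_jet (hu : HasJet u u₁ u₂) (h : u = w) (h₁ : u₁ = w₁) (h₂ : u₂ = w₂) :
    HasJet w w₁ w₂ := by
  subst h h₁ h₂; exact hu

lemma const (c : ℝ) : HasJet (fun _ => c) 0 0 :=
  ⟨contDiffAt_const, by simp, by simp⟩

lemma linear (l : Plane →L[ℝ] ℝ) : HasJet l (fun A => l (EuclideanSpace.single A 1)) 0 :=
  ⟨l.contDiff.contDiffAt, by simp, by simp⟩

lemma add (hu : HasJet u u₁ u₂) (hw : HasJet w w₁ w₂) :
    HasJet (fun y => u y + w y) (u₁ + w₁) (u₂ + w₂) := by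
  refine ⟨hu.contDiffAt.add hw.contDiffAt, fun A => ?_, fun A B => ?_⟩
  · simp [fderiv_fun_add hu.differentiableAt hw.differentiableAt, hu.first, hw.first]
  · have h : (fun y => fderiv ℝ (fun y => u y + w y) y (EuclideanSpace.single B 1))
        =ᶠ[nhds 0] fun y => fderiv ℝ u y (EuclideanSpace.single B 1)
          + fderiv ℝ w y (EuclideanSpace.single B 1) := by
      filter_upwards [hu.eventually_differentiableAt, hw.eventually_differentiableAt] with y h1 h2
      simp [fderiv_fun_add h1 h2]
    rw [h.fderiv_eq, fderiv_fun_add (hu.differentiableAt_fderiv _) (hw.differentiableAt_fderiv _)]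
    simp [hu.second, hw.second]

lemma mul (hu : HasJet u u₁ u₂) (hw : HasJet w w₁ w₂) :
    HasJet (fun y => u y * w y) (fun A => u₁ A * w 0 + u 0 * w₁ A)
      (fun A B => u₂ A B * w 0 + u₁ A * w₁ B + u₁ B * w₁ A + u 0 * w₂ A B) := by
  refine ⟨hu.contDiffAt.mul hw.contDiffAt, fun A => ?_, fun A B => ?_⟩
  · simp [fderiv_fun_mul hu.differentiableAt hw.differentiableAt, hu.first, hw.first]; ring
  · have h : (fun y => fderiv ℝ (fun y => u y * w y) y (EuclideanSpace.single B 1))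
        =ᶠ[nhds 0] fun y => u y * fderiv ℝ w y (EuclideanSpace.single B 1)
          + w y * fderiv ℝ u y (EuclideanSpace.single B 1) := by
      filter_upwards [hu.eventually_differentiableAt, hw.eventually_differentiableAt] with y h1 h2
      simp [fderiv_fun_mul h1 h2]
    rw [h.fderiv_eq, fderiv_fun_add
        (hu.differentiableAt.fun_mul (hw.differentiableAt_fderiv _))
        (hw.differentiableAt.fun_mul (hu.differentiableAt_fderiv _)),
      fderiv_fun_mul hu.differentiableAt (hw.differentiableAt_fderiv _),
      fderiv_fun_mul hw.differentiableAt (hu.differentiableAt_fderiv _)]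
    simp [hu.first, hw.first, hu.second, hw.second]; ring

lemma comp {H : ℝ → ℝ} (hu : HasJet u u₁ u₂) (hH : ContDiffAt ℝ 2 H (u 0)) :
    HasJet (fun y => H (u y)) (fun A => deriv H (u 0) * u₁ A)
      (fun A B => deriv (deriv H) (u 0) * u₁ A * u₁ B + deriv H (u 0) * u₂ A B) := by
  have hHd : ∀ᶠ x in nhds (u 0), DifferentiableAt ℝ H x := by
    filter_upwards [hH.eventually (by norm_num)] with x hx
    exact hx.differentiableAt (by norm_num)
  have hH' : DifferentiableAt ℝ (deriv H) (u 0) := by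
    have := ((hH.fderiv_right (m := 1) (by norm_num)).differentiableAt one_ne_zero).clm_apply
      (differentiableAt_const (1 : ℝ))
    exact this
  have hchain {y : Plane} (h1 : DifferentiableAt ℝ u y) (h2 : DifferentiableAt ℝ H (u y)) :
      fderiv ℝ (fun y => H (u y)) y = deriv H (u y) • fderiv ℝ u y :=
    (h2.hasDerivAt.comp_hasFDerivAt y h1.hasFDerivAt).fderiv
  refine ⟨hH.comp 0 hu.contDiffAt, fun A => ?_, fun A B => ?_⟩
  · rw [hchain hu.differentiableAt hHd.self_of_nhds]
    simp [hu.first]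
  · have h : (fun y => fderiv ℝ (fun y => H (u y)) y (EuclideanSpace.single B 1))
        =ᶠ[nhds 0] fun y => deriv H (u y) * fderiv ℝ u y (EuclideanSpace.single B 1) := by
      filter_upwards [hu.eventually_differentiableAt,
        hu.differentiableAt.continuousAt.eventually hHd] with y h1 h2
      rw [hchain h1 h2]; simp
    have h3 : HasFDerivAt (fun y => deriv H (u y)) (deriv (deriv H) (u 0) • fderiv ℝ u 0) 0 :=
      hH'.hasDerivAt.comp_hasFDerivAt 0 hu.differentiableAt.hasFDerivAt
    rw [h.fderiv_eq, fderiv_fun_mul h3.differentiableAt (hu.differentiableAt_fderiv _), h3.fderiv]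
    simp [hu.first, hu.second]; ring

end HasJet

instance fact_finrank_three : Fact (Module.finrank ℝ (EuclideanSpace ℝ (Fin 3)) = 2 + 1) :=
  ⟨finrank_euclideanSpace_fin⟩

/-- The inverse of the chart centred at `q` is the inverse stereographic projection, composed with
an isometry of the coordinate plane onto the tangent plane at `q`. -/
lemma exists_isometry_chart_symm (q : S2) :
    ∃ U : Plane →ₗᵢ[ℝ] EuclideanSpace ℝ (Fin 3),
      (∀ y, inner ℝ (U y) (q : EuclideanSpace ℝ (Fin 3)) = 0) ∧
      ∀ y, (((extChartAt (𝓡 2) q).symm y : S2) : EuclideanSpace ℝ (Fin 3))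
        = (‖y‖ ^ 2 + 4)⁻¹ • ((4 : ℝ) • U y + (4 - ‖y‖ ^ 2) • (q : EuclideanSpace ℝ (Fin 3))) := by
  let W : (Submodule.span ℝ {((-q : S2) : EuclideanSpace ℝ (Fin 3))})ᗮ ≃ₗᵢ[ℝ] Plane :=
    (OrthonormalBasis.fromOrthogonalSpanSingleton 2 (ne_zero_of_mem_unit_sphere (-q))).repr
  refine ⟨(Submodule.subtypeₗᵢ _).comp W.symm.toLinearIsometry, fun y => ?_, fun y => ?_⟩
  · have h := Submodule.mem_orthogonal_singleton_iff_inner_left.mp (W.symm y).2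
    have h2 : inner ℝ (W.symm y : EuclideanSpace ℝ (Fin 3)) (-(q : EuclideanSpace ℝ (Fin 3))) = 0 :=
      h
    rw [inner_neg_right, neg_eq_zero] at h2
    exact h2
  · have h := stereographic'_symm_apply (n := 2) (-q) y
    have h2 : ‖(W.symm y : EuclideanSpace ℝ (Fin 3))‖ = ‖y‖ := by
      rw [Submodule.norm_coe, W.symm.norm_map]
    change ((((stereographic' 2 (-q)).symm y : S2)) : EuclideanSpace ℝ (Fin 3)) = _
    rw [h]
    simp only []
    change (‖(W.symm y : EuclideanSpace ℝ (Fin 3))‖ ^ 2 + 4)⁻¹ • (4 : ℝ) •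
      (W.symm y : EuclideanSpace ℝ (Fin 3)) +
      (‖(W.symm y : EuclideanSpace ℝ (Fin 3))‖ ^ 2 + 4)⁻¹ •
      (‖(W.symm y : EuclideanSpace ℝ (Fin 3))‖ ^ 2 - 4) • (-(q : EuclideanSpace ℝ (Fin 3)))
      = (‖y‖ ^ 2 + 4)⁻¹ • ((4 : ℝ) • (W.symm y : EuclideanSpace ℝ (Fin 3))
        + (4 - ‖y‖ ^ 2) • (q : EuclideanSpace ℝ (Fin 3)))
    rw [h2]
    module

lemma extChartAt_sphere_self (q : S2) : extChartAt (𝓡 2) q q = 0 := by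
  obtain ⟨U, hUq, hU⟩ := exists_isometry_chart_symm q
  set y := extChartAt (𝓡 2) q q with hy
  have h := hU y
  rw [hy, extChartAt_to_inv, ← hy] at h
  have h2 := congrArg (fun x => inner ℝ (U y) x) h
  simp only [inner_smul_right, inner_add_right, hUq, mul_zero, add_zero,
    real_inner_self_eq_norm_sq, U.norm_map] at h2
  have h3 : (‖y‖ ^ 2 + 4)⁻¹ ≠ 0 := by positivity
  have h4 : ‖y‖ ^ 2 = 0 := by
    rcases mul_eq_zero.mp h2.symm with h | h
    · exact absurd h h3
    · linarith
  simpa using h4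

lemma hasJet_coord (C : Fin 2) : HasJet (fun y : Plane => y C) (fun A => if A = C then 1 else 0) 0 :=
  (HasJet.linear (EuclideanSpace.proj C : Plane →L[ℝ] ℝ)).congr_jet rfl
    (by funext A; simp [eq_comm]) rfl

lemma hasJet_norm_sq : HasJet (fun y : Plane => ‖y‖ ^ 2) 0 (fun A B => if A = B then 2 else 0) := by
  refine (((hasJet_coord 0).mul (hasJet_coord 0)).add
    ((hasJet_coord 1).mul (hasJet_coord 1))).congr_jet ?_ ?_ ?_
  · funext y
    rw [EuclideanSpace.real_norm_sq_eq, Fin.sum_univ_two, sq, sq]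
  · funext A; simp
  · funext A B
    fin_cases A <;> fin_cases B <;> norm_num

/-- An orthonormal frame of the tangent plane of the unit sphere at `q`. -/
structure IsFrame (q : S2) (U : Fin 2 → Fin 3 → ℝ) : Prop where
  orthonormal : ∀ A B, ∑ j, U A j * U B j = if A = B then 1 else 0
  tangent : ∀ A, ∑ j, U A j * (q : EuclideanSpace ℝ (Fin 3)) j = 0

/-- The stereographic chart centred at `q` is normal there to second order: it has an orthonormal
coordinate frame, and the second derivatives of the inclusion point along `q`. -/
lemma exists_frame (q : S2) : ∃ U : Fin 2 → Fin 3 → ℝ,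
    IsFrame q U ∧ ∀ j, HasJet (fun y => (((extChartAt (𝓡 2) q).symm y : S2) : EuclideanSpace ℝ (Fin 3)) j)
      (fun A => U A j)
      (fun A B => if A = B then -(q : EuclideanSpace ℝ (Fin 3)) j else 0) := by
  obtain ⟨U, hUq, hU⟩ := exists_isometry_chart_symm q
  refine ⟨fun A j => U (EuclideanSpace.single A 1) j, ⟨fun A B => ?_, fun A => ?_⟩, fun j => ?_⟩
  · have h := U.inner_map_map (EuclideanSpace.single B 1) (EuclideanSpace.single A 1)
    rw [EuclideanSpace.inner_single_left, PiLp.inner_apply, PiLp.single_apply] at h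
    simpa [eq_comm] using h
  · have h := hUq (EuclideanSpace.single A 1)
    simpa [PiLp.inner_apply, mul_comm] using h
  · have hlin := HasJet.linear ((EuclideanSpace.proj j : EuclideanSpace ℝ (Fin 3) →L[ℝ] ℝ).comp
      U.toContinuousLinearMap)
    have hden := (hasJet_norm_sq.add (HasJet.const 4)).comp (H := fun x => x⁻¹)
      (contDiffAt_inv ℝ (by norm_num))
    have hnum := ((HasJet.const 4).mul hlin).add
      (((HasJet.const 4).add ((HasJet.const (-1)).mul hasJet_norm_sq)).mul
        (HasJet.const ((q : EuclideanSpace ℝ (Fin 3)) j)))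
    refine (hden.mul hnum).congr_jet ?_ ?_ ?_
    · funext y
      rw [hU]
      simp
      ring
    · funext A
      simp
    · funext A B
      by_cases hAB : A = B
      · subst hAB; simp; norm_num; ring
      · simp [hAB]

/-- Pythagoras' theorem in the orthonormal basis that consists of `q` and a tangent frame. -/
lemma IsFrame.sum_sq {q : S2} {U : Fin 2 → Fin 3 → ℝ} (hU : IsFrame q U)
    (n : EuclideanSpace ℝ (Fin 3)) :
    ∑ A, (∑ j, n j * U A j) ^ 2 + (∑ j, n j * (q : EuclideanSpace ℝ (Fin 3)) j) ^ 2
      = ∑ j, n j ^ 2 := by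
  obtain ⟨h₁, h₂⟩ := hU
  have hq : ∑ j, (q : EuclideanSpace ℝ (Fin 3)) j * (q : EuclideanSpace ℝ (Fin 3)) j = 1 := by
    have := norm_eq_of_mem_sphere q
    have h2 := EuclideanSpace.real_norm_sq_eq (q : EuclideanSpace ℝ (Fin 3))
    rw [this] at h2
    simp only [← sq]
    linarith
  let O : Matrix (Fin 3) (Fin 3) ℝ :=
    Matrix.of ![U 0, U 1, fun j => (q : EuclideanSpace ℝ (Fin 3)) j]
  have hO : O * O.transpose = 1 := by
    have h2' (A) : ∑ j, (q : EuclideanSpace ℝ (Fin 3)) j * U A j = 0 := by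
      rw [← h₂ A]; exact Finset.sum_congr rfl fun j _ => mul_comm _ _
    ext a b
    rw [Matrix.mul_apply]
    fin_cases a <;> fin_cases b <;> simp [O, h₁, h₂, h2', hq]
  have hO' : O.transpose * O = 1 := mul_eq_one_comm.mp hO
  have he (i j : Fin 3) : U 0 i * U 0 j + U 1 i * U 1 j
      + (q : EuclideanSpace ℝ (Fin 3)) i * (q : EuclideanSpace ℝ (Fin 3)) j
      = if i = j then 1 else 0 := by
    have := congrFun (congrFun hO' i) j
    rw [Matrix.mul_apply, Matrix.one_apply] at this
    simpa [O, Fin.sum_univ_three] using this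
  simp only [Fin.sum_univ_two, Fin.sum_univ_three]
  have e00 := he 0 0
  have e11 := he 1 1
  have e22 := he 2 2
  have e01 := he 0 1
  have e02 := he 0 2
  have e12 := he 1 2
  simp at e00 e11 e22 e01 e02 e12
  linear_combination n 0 ^ 2 * e00 + n 1 ^ 2 * e11 + n 2 ^ 2 * e22 + 2 * n 0 * n 1 * e01
    + 2 * n 0 * n 2 * e02 + 2 * n 1 * n 2 * e12

lemma tangentVec_of_hasJet {Φ : S2 → Pt} {q : S2} {e : Fin 4 → Fin 2 → ℝ}
    {d : Fin 4 → Fin 2 → Fin 2 → ℝ}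
    (h : ∀ μ, HasJet (fun y => localParam Φ q y μ) (e μ) (d μ)) (A : Fin 2) (μ : Fin 4) :
    tangentVec Φ q A μ = e μ A := by
  rw [tangentVec, extChartAt_sphere_self, ← (h μ).first A,
    fderiv_pi (φ := fun μ y => localParam Φ q y μ) fun μ => (h μ).differentiableAt]
  rfl

lemma secondDeriv_of_hasJet {Φ : S2 → Pt} {q : S2} {e : Fin 4 → Fin 2 → ℝ}
    {d : Fin 4 → Fin 2 → Fin 2 → ℝ}
    (h : ∀ μ, HasJet (fun y => localParam Φ q y μ) (e μ) (d μ)) (A B : Fin 2) (μ : Fin 4) :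
    secondDeriv Φ q A B μ = d μ A B := by
  have hev : (fun y => fderiv ℝ (localParam Φ q) y (EuclideanSpace.single B 1)) =ᶠ[nhds 0]
      fun y μ => fderiv ℝ (fun y => localParam Φ q y μ) y (EuclideanSpace.single B 1) := by
    have hall : ∀ᶠ y in nhds (0 : Plane), ∀ μ, DifferentiableAt ℝ (fun y => localParam Φ q y μ) y :=
      Filter.eventually_all.mpr fun μ => (h μ).eventually_differentiableAt
    filter_upwards [hall] with y hy
    rw [fderiv_pi (φ := fun μ y => localParam Φ q y μ) hy]
    rfl
  rw [secondDeriv, extChartAt_sphere_self, ← (h μ).second A B, hev.fderiv_eq,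
    fderiv_pi (φ := fun μ y => fderiv ℝ (fun y => localParam Φ q y μ) y
      (EuclideanSpace.single B 1)) fun μ => (h μ).differentiableAt_fderiv _]
  rfl

lemma roundGram_eq_one (q : S2) : roundGram q = 1 := by
  obtain ⟨U, ⟨h₁, -⟩, hU⟩ := exists_frame q
  have ht (A : Fin 2) (j : Fin 3) :
      tangentVec (fun x : S2 => (x : EuclideanSpace ℝ (Fin 3))) q A j = U A j := by
    have hd : DifferentiableAt ℝ
        (localParam (fun x : S2 => (x : EuclideanSpace ℝ (Fin 3))) q) 0 :=
      differentiableAt_euclidean.mpr fun j => (hU j).differentiableAt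
    rw [tangentVec, extChartAt_sphere_self, ← (hU j).first A]
    have h := ((EuclideanSpace.proj j : EuclideanSpace ℝ (Fin 3) →L[ℝ] ℝ).hasFDerivAt.comp 0
      hd.hasFDerivAt).fderiv
    exact (congrArg (fun L : Plane →L[ℝ] ℝ => L (EuclideanSpace.single A 1)) h).symm
  have hin (A B : Fin 2) : inner ℝ (tangentVec (fun x : S2 => (x : EuclideanSpace ℝ (Fin 3))) q A)
      (tangentVec (fun x : S2 => (x : EuclideanSpace ℝ (Fin 3))) q B)
      = if A = B then 1 else 0 := by
    rw [← h₁ A B]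
    simp [PiLp.inner_apply, ht, mul_comm]
  rw [roundGram, Matrix.det_fin_two]
  simp [hin]

/-! ### Axisymmetric graphs over the round spheres -/

/-- The inner product of the direction `q` with the axis `n`. -/
def height (n : EuclideanSpace ℝ (Fin 3)) (q : S2) : ℝ :=
  ∑ j, n j * (q : EuclideanSpace ℝ (Fin 3)) j

/-- The surface on which `v = V(t)` and `r = R(t)` at the directions of height `t`. -/
def graphSphere (n : EuclideanSpace ℝ (Fin 3)) (V R : ℝ → ℝ) (q : S2) : Pt :=
  Fin.cons (V (height n q)) fun j => R (height n q) * (q : EuclideanSpace ℝ (Fin 3)) j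

/-- The vector whose `v`-component is `x₀`, whose radial component is `x₁`, and whose components
along the frame `U` of the sphere are `y`. -/
def frameVec (q : S2) (U : Fin 2 → Fin 3 → ℝ) (x₀ x₁ : ℝ) (y : Fin 2 → ℝ) : Pt :=
  Fin.cons x₀ fun j => x₁ * (q : EuclideanSpace ℝ (Fin 3)) j + ∑ A, y A * U A j

lemma sum_coord_sq (q : S2) : ∑ j, (q : EuclideanSpace ℝ (Fin 3)) j ^ 2 = 1 := by
  rw [← EuclideanSpace.real_norm_sq_eq, norm_eq_of_mem_sphere q, one_pow]

/-- The first and second derivatives of an axisymmetric graph, in a frame in which the axis has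
the tangential components `ν`. -/
lemma exists_frame_graphSphere (n q : S2) {V R : ℝ → ℝ}
    (hV : ContDiffAt ℝ 2 V (height n q)) (hR : ContDiffAt ℝ 2 R (height n q)) :
    ∃ (U : Fin 2 → Fin 3 → ℝ) (ν : Fin 2 → ℝ), IsFrame q U ∧
      ν 0 ^ 2 + ν 1 ^ 2 = 1 - height n q ^ 2 ∧
      (∀ A, tangentVec (graphSphere n V R) q A = frameVec q U (deriv V (height n q) * ν A)
        (deriv R (height n q) * ν A) (fun C => if C = A then R (height n q) else 0)) ∧
      ∀ A B, secondDeriv (graphSphere n V R) q A B = frameVec q U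
        (deriv (deriv V) (height n q) * ν A * ν B
          - deriv V (height n q) * (if A = B then height n q else 0))
        (deriv (deriv R) (height n q) * ν A * ν B
          - deriv R (height n q) * (if A = B then height n q else 0)
          - if A = B then R (height n q) else 0)
        (fun C => (if C = B then deriv R (height n q) * ν A else 0)
          + if C = A then deriv R (height n q) * ν B else 0) := by
  obtain ⟨U, hF, hU⟩ := exists_frame q
  refine ⟨U, fun A => ∑ j, (n : EuclideanSpace ℝ (Fin 3)) j * U A j, hF, ?_, ?_⟩
  · have h := hF.sum_sq n
    rw [sum_coord_sq, Fin.sum_univ_two] at h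
    rw [height]; linarith
  set t := height n q with ht
  set ν : Fin 2 → ℝ := fun A => ∑ j, (n : EuclideanSpace ℝ (Fin 3)) j * U A j with hν
  have hsymm0 : (extChartAt (𝓡 2) q).symm 0 = q := by
    rw [← extChartAt_sphere_self q, extChartAt_to_inv]
  have hheight : HasJet (fun y => height n ((extChartAt (𝓡 2) q).symm y)) ν
      (fun A B => if A = B then -t else 0) := by
    refine ((((HasJet.const ((n : EuclideanSpace ℝ (Fin 3)) 0)).mul (hU 0)).add
      ((HasJet.const ((n : EuclideanSpace ℝ (Fin 3)) 1)).mul (hU 1))).add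
      ((HasJet.const ((n : EuclideanSpace ℝ (Fin 3)) 2)).mul (hU 2))).congr_jet ?_ ?_ ?_
    · funext y; simp only [height, Fin.sum_univ_three]
    · funext A; simp [hν, Fin.sum_univ_three]
    · funext A B
      by_cases hAB : A = B
      · simp [hAB, ht, height, Fin.sum_univ_three]; ring
      · simp [hAB]
  have h0 : height n ((extChartAt (𝓡 2) q).symm 0) = t := by rw [hsymm0]
  have hVj := hheight.comp (H := V) (by rw [h0]; exact hV)
  have hRj := hheight.comp (H := R) (by rw [h0]; exact hR)
  simp only [h0] at hVj hRj
  have hj : ∀ μ, HasJet (fun y => localParam (graphSphere n V R) q y μ)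
      ((Fin.cons (fun A => deriv V t * ν A) (fun j A => deriv R t * ν A *
        (q : EuclideanSpace ℝ (Fin 3)) j + R t * U A j) : Fin 4 → Fin 2 → ℝ) μ)
      ((Fin.cons (fun A B => deriv (deriv V) t * ν A * ν B + deriv V t * (if A = B then -t else 0))
        (fun j A B => (deriv (deriv R) t * ν A * ν B + deriv R t * (if A = B then -t else 0)) *
          (q : EuclideanSpace ℝ (Fin 3)) j + deriv R t * ν A * U B j + deriv R t * ν B * U A j
          + R t * (if A = B then -(q : EuclideanSpace ℝ (Fin 3)) j else 0)) :
            Fin 4 → Fin 2 → Fin 2 → ℝ) μ) := by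
    intro μ
    refine Fin.cases ?_ (fun j => ?_) μ
    · exact hVj
    · refine (hRj.mul (hU j)).congr_jet rfl ?_ ?_
      · funext A; simp only [hsymm0]; rfl
      · funext A B; simp only [hsymm0]; rfl
  refine ⟨fun A => ?_, fun A B => ?_⟩
  · funext μ
    rw [tangentVec_of_hasJet hj]
    refine Fin.cases ?_ (fun j => ?_) μ
    · simp [frameVec]
    · simp [frameVec]
  · funext μ
    rw [secondDeriv_of_hasJet hj]
    refine Fin.cases ?_ (fun j => ?_) μ
    · by_cases hAB : A = B <;> simp [frameVec, hAB]; ring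
    · simp only [frameVec, Fin.cons_succ, Fin.sum_univ_two]
      fin_cases A <;> fin_cases B <;> simp <;> ring

lemma height_mem_Icc (n q : S2) : height n q ∈ Set.Icc (-1 : ℝ) 1 := by
  obtain ⟨U, hF, -⟩ := exists_frame q
  have h := hF.sum_sq n
  rw [sum_coord_sq] at h
  have h2 : 0 ≤ ∑ A, (∑ j, (n : EuclideanSpace ℝ (Fin 3)) j * U A j) ^ 2 := by positivity
  have h3 : height n q ^ 2 ≤ 1 := by rw [height]; linarith
  exact abs_le.mp ((sq_le_one_iff_abs_le_one _).mp h3)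

lemma areaRadius_cons {v r : ℝ} (hr : 0 ≤ r) (q : S2) :
    areaRadius (Fin.cons v fun j => r * (q : EuclideanSpace ℝ (Fin 3)) j) = r := by
  have h := sum_coord_sq q
  rw [Fin.sum_univ_three] at h
  rw [areaRadius, show (1 : Fin 4) = Fin.succ 0 from rfl, show (2 : Fin 4) = Fin.succ 1 from rfl,
    show (3 : Fin 4) = Fin.succ 2 from rfl]
  simp only [Fin.cons_succ]
  rw [show (r * (q : EuclideanSpace ℝ (Fin 3)) 0) ^ 2 + (r * (q : EuclideanSpace ℝ (Fin 3)) 1) ^ 2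
    + (r * (q : EuclideanSpace ℝ (Fin 3)) 2) ^ 2 = r ^ 2 by linear_combination r ^ 2 * h,
    Real.sqrt_sq hr]

lemma vr_cons {v r : ℝ} (hr : 0 ≤ r) (q : S2) :
    vr (Fin.cons v fun j => r * (q : EuclideanSpace ℝ (Fin 3)) j) = (v, r) := by
  rw [vr, areaRadius_cons hr]; rfl

lemma dr_cons {v r : ℝ} (hr : 0 < r) (q : S2) (j : Fin 3) :
    dr (Fin.cons v fun j => r * (q : EuclideanSpace ℝ (Fin 3)) j) j.succ
      = (q : EuclideanSpace ℝ (Fin 3)) j := by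
  rw [dr, areaRadius_cons hr.le, if_neg (Fin.succ_ne_zero j), Fin.cons_succ]
  field_simp

namespace SphericalSpacetime

variable {M : SphericalSpacetime}

lemma sum_dr_frameVec {v r : ℝ} (hr : 0 < r) {q : S2} {U : Fin 2 → Fin 3 → ℝ} (hU : IsFrame q U)
    (x₀ x₁ : ℝ) (y : Fin 2 → ℝ) :
    ∑ μ, dr (Fin.cons v fun j => r * (q : EuclideanSpace ℝ (Fin 3)) j) μ * frameVec q U x₀ x₁ y μ
      = x₁ := by
  have h0 := hU.tangent 0
  have h1 := hU.tangent 1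
  have hq := sum_coord_sq q
  rw [Fin.sum_univ_three] at h0 h1 hq
  rw [Fin.sum_univ_succ]
  simp only [dr_cons hr, dr_zero, frameVec, Fin.cons_succ, Fin.sum_univ_three, Fin.sum_univ_two]
  linear_combination y 0 * h0 + y 1 * h1 + x₁ * hq

lemma sum_dv_frameVec {q : S2} {U : Fin 2 → Fin 3 → ℝ} (x₀ x₁ : ℝ) (y : Fin 2 → ℝ) :
    ∑ μ, dv μ * frameVec q U x₀ x₁ y μ = x₀ := by
  rw [Fin.sum_univ_succ]
  simp [dv, frameVec]

lemma sum_sphereMetric_frameVec {v r : ℝ} (hr : 0 < r) {q : S2} {U : Fin 2 → Fin 3 → ℝ}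
    (hU : IsFrame q U) (x₀ x₁ y₀ y₁ : ℝ) (x y : Fin 2 → ℝ) :
    ∑ μ, ∑ ν, sphereMetric (Fin.cons v fun j => r * (q : EuclideanSpace ℝ (Fin 3)) j) μ ν
      * frameVec q U x₀ x₁ x μ * frameVec q U y₀ y₁ y ν = x 0 * y 0 + x 1 * y 1 := by
  have hX := sum_dr_frameVec (v := v) hr hU x₀ x₁ x
  have hY := sum_dr_frameVec (v := v) hr hU y₀ y₁ y
  have hsp : ∑ j : Fin 3, frameVec q U x₀ x₁ x j.succ * frameVec q U y₀ y₁ y j.succ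
      = x₁ * y₁ + (x 0 * y 0 + x 1 * y 1) := by
    have h0 := hU.tangent 0
    have h1 := hU.tangent 1
    have hq := sum_coord_sq q
    have h00 := hU.orthonormal 0 0
    have h01 := hU.orthonormal 0 1
    have h11 := hU.orthonormal 1 1
    simp only [Fin.sum_univ_three, if_true, zero_ne_one, if_false] at h0 h1 hq h00 h01 h11
    simp only [frameVec, Fin.cons_succ, Fin.sum_univ_three, Fin.sum_univ_two]
    linear_combination x₁ * y₁ * hq + (x₁ * y 0 + x 0 * y₁) * h0 + (x₁ * y 1 + x 1 * y₁) * h1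
      + x 0 * y 0 * h00 + x 1 * y 1 * h11 + (x 0 * y 1 + x 1 * y 0) * h01
  set p : Pt := Fin.cons v fun j => r * (q : EuclideanSpace ℝ (Fin 3)) j
  have hsplit : ∑ μ, ∑ ν, sphereMetric p μ ν * frameVec q U x₀ x₁ x μ * frameVec q U y₀ y₁ y ν
      = ∑ j : Fin 3, frameVec q U x₀ x₁ x j.succ * frameVec q U y₀ y₁ y j.succ
        - (∑ μ, dr p μ * frameVec q U x₀ x₁ x μ) * (∑ μ, dr p μ * frameVec q U y₀ y₁ y μ) := by
    simp only [Fin.sum_univ_four, Fin.sum_univ_three, sphereMetric, dr_zero]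
    simp
    ring
  rw [hsplit, hsp, hX, hY]
  ring

lemma dot_eq (p X Y : Pt) :
    M.metric.dot p X Y =
      -(Real.exp (M.β (vr p)) ^ 2 * M.warp (vr p)) * (∑ μ, dv μ * X μ) * (∑ μ, dv μ * Y μ)
        + Real.exp (M.β (vr p)) * ((∑ μ, dv μ * X μ) * (∑ μ, dr p μ * Y μ)
          + (∑ μ, dr p μ * X μ) * (∑ μ, dv μ * Y μ))
        + ∑ μ, ∑ ν, sphereMetric p μ ν * X μ * Y ν := by
  simp only [MetricField.dot, metric_apply, Fin.sum_univ_four]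
  ring

lemma sum_christoffel_eq {p : Pt} (hp : p ∈ M.carrier) (X Y : Pt) (μ : Fin 4) :
    ∑ ν, ∑ ρ, M.metric.christoffel p μ ν ρ * X ν * Y ρ =
      dv μ * (M.coefG (vr p) * (∑ μ, dv μ * X μ) * (∑ μ, dv μ * Y μ)
        - (Real.exp (M.β (vr p)))⁻¹ * (∑ μ, ∑ ν, sphereMetric p μ ν * X μ * Y ν) / areaRadius p)
      + dr p μ * (M.coefA (vr p) * (∑ μ, dv μ * X μ) * (∑ μ, dv μ * Y μ)
        - M.coefQ (vr p) * ((∑ μ, dv μ * X μ) * (∑ μ, dr p μ * Y μ)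
          + (∑ μ, dr p μ * X μ) * (∑ μ, dv μ * Y μ))
        + partialR M.β (vr p) * (∑ μ, dr p μ * X μ) * (∑ μ, dr p μ * Y μ)
        + (1 - M.warp (vr p)) * (∑ μ, ∑ ν, sphereMetric p μ ν * X μ * Y ν) / areaRadius p) := by
  simp only [christoffel_eq hp, Fin.sum_univ_four]
  ring

lemma dot_frameVec {v r : ℝ} (hr : 0 < r) {q : S2} {U : Fin 2 → Fin 3 → ℝ}
    (hU : IsFrame q U) (x₀ x₁ y₀ y₁ : ℝ) (x y : Fin 2 → ℝ) :
    M.metric.dot (Fin.cons v fun j => r * (q : EuclideanSpace ℝ (Fin 3)) j)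
      (frameVec q U x₀ x₁ x) (frameVec q U y₀ y₁ y) =
      -(Real.exp (M.β (v, r)) ^ 2 * M.warp (v, r)) * x₀ * y₀
        + Real.exp (M.β (v, r)) * (x₀ * y₁ + x₁ * y₀) + (x 0 * y 0 + x 1 * y 1) := by
  rw [dot_eq, sum_dr_frameVec hr hU, sum_dr_frameVec hr hU, sum_dv_frameVec, sum_dv_frameVec,
    sum_sphereMetric_frameVec hr hU, vr_cons hr.le]

lemma sum_christoffel_frameVec {v r : ℝ} (hz : (v, r) ∈ M.dom) {q : S2} {U : Fin 2 → Fin 3 → ℝ}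
    (hU : IsFrame q U) (x₀ x₁ y₀ y₁ : ℝ) (x y : Fin 2 → ℝ) :
    (fun μ => ∑ ν, ∑ ρ, M.metric.christoffel
      (Fin.cons v fun j => r * (q : EuclideanSpace ℝ (Fin 3)) j) μ ν ρ
        * frameVec q U x₀ x₁ x ν * frameVec q U y₀ y₁ y ρ) =
      frameVec q U (M.coefG (v, r) * x₀ * y₀
          - (Real.exp (M.β (v, r)))⁻¹ * (x 0 * y 0 + x 1 * y 1) / r)
        (M.coefA (v, r) * x₀ * y₀ - M.coefQ (v, r) * (x₀ * y₁ + x₁ * y₀)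
          + partialR M.β (v, r) * x₁ * y₁
          + (1 - M.warp (v, r)) * (x 0 * y 0 + x 1 * y 1) / r) 0 := by
  have hr : 0 < r := M.pos_of_mem _ hz
  have hp : (Fin.cons v fun j => r * (q : EuclideanSpace ℝ (Fin 3)) j : Pt) ∈ M.carrier := by
    rw [carrier, Set.mem_ofPred_eq, vr_cons hr.le]; exact hz
  funext μ
  rw [sum_christoffel_eq hp, sum_dr_frameVec hr hU, sum_dr_frameVec hr hU, sum_dv_frameVec,
    sum_dv_frameVec, sum_sphereMetric_frameVec hr hU, vr_cons hr.le, areaRadius_cons hr.le]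
  refine Fin.cases ?_ (fun j => ?_) μ
  · simp [dr_zero, frameVec, dv]
  · rw [dr_cons hr]
    simp [frameVec, dv]
    ring

lemma frameVec_add (q : S2) (U : Fin 2 → Fin 3 → ℝ) (x₀ x₁ y₀ y₁ : ℝ) (x y : Fin 2 → ℝ) :
    frameVec q U x₀ x₁ x + frameVec q U y₀ y₁ y = frameVec q U (x₀ + y₀) (x₁ + y₁) (x + y) := by
  funext μ
  refine Fin.cases ?_ (fun j => ?_) μ
  · simp [frameVec]
  · simp [frameVec]; ring

lemma kay_add_ell_cons {v r : ℝ} (hr : 0 < r) (q : S2) (U : Fin 2 → Fin 3 → ℝ) :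
    M.kay (Fin.cons v fun j => r * (q : EuclideanSpace ℝ (Fin 3)) j)
      + M.ell (Fin.cons v fun j => r * (q : EuclideanSpace ℝ (Fin 3)) j)
      = frameVec q U 1 ((1 / 2) * M.warp (v, r) * Real.exp (M.β (v, r))
          - (Real.exp (M.β (v, r)))⁻¹) 0 := by
  have hrad (p : Pt) : radialVec p = dr p := rfl
  have hf (p : Pt) : M.radFactor p = M.warp (vr p) := rfl
  funext μ
  simp only [kay, ell, hrad, hf, vr_cons hr.le, Real.exp_neg, Pi.add_apply, Pi.smul_apply,
    Pi.neg_apply, smul_eq_mul]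
  refine Fin.cases ?_ (fun j => ?_) μ
  · simp [dr_zero, frameVec]
  · rw [dr_cons hr]
    simp [frameVec]
    ring

end SphericalSpacetime

/-! ### Estimates uniform over a compact set of local data -/

/-- The numbers on which the first and second fundamental forms of the graph
`v = v₀ + s a(t)`, `r = r₀ + s b(t)` at a point depend, apart from `s`: `1 - 2m/r` is `s φ`,
`E = e^β`, `Ei` and `Ri` are the inverses of `E` and of the radius `R`, the Christoffel symbols
are determined by `G`, `A`, `Q` and `br = ∂_r β`, the derivatives of `a` and `b` are `a₁`, `a₂`,
`b₁` and `b₂`, and the axis has height `t` and tangential components `ν`. -/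
structure GraphData where
  φ : ℝ
  E : ℝ
  Ei : ℝ
  R : ℝ
  Ri : ℝ
  G : ℝ
  A : ℝ
  Q : ℝ
  br : ℝ
  a₁ : ℝ
  a₂ : ℝ
  b₁ : ℝ
  b₂ : ℝ
  t : ℝ
  ν : Fin 2 → ℝ

namespace GraphData

variable (d : GraphData)

/-- The squared length of the tangential part of the axis. -/
def nuSq : ℝ := d.ν 0 ^ 2 + d.ν 1 ^ 2

/-- The first fundamental form. -/
def gram (s : ℝ) (A B : Fin 2) : ℝ :=
  -(d.E ^ 2 * (s * d.φ)) * (s * d.a₁ * d.ν A) * (s * d.a₁ * d.ν B)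
    + d.E * (s * d.a₁ * d.ν A * (s * d.b₁ * d.ν B) + s * d.b₁ * d.ν A * (s * d.a₁ * d.ν B))
    + d.R ^ 2 * if A = B then 1 else 0

/-- The `v`-component of `∇_{e_A} e_B`. -/
def covV (s : ℝ) (A B : Fin 2) : ℝ :=
  s * (d.a₂ * d.ν A * d.ν B - d.a₁ * d.t * if A = B then 1 else 0)
    + s ^ 2 * (d.G * d.a₁ ^ 2 * d.ν A * d.ν B) - d.Ei * d.R * if A = B then 1 else 0

/-- The radial component of `∇_{e_A} e_B`, divided by `s`. -/
def covR (s : ℝ) (A B : Fin 2) : ℝ :=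
  d.b₂ * d.ν A * d.ν B - (d.b₁ * d.t + d.φ * d.R) * (if A = B then 1 else 0)
    + s * ((d.A * d.a₁ ^ 2 - 2 * d.Q * d.a₁ * d.b₁ + d.br * d.b₁ ^ 2) * d.ν A * d.ν B)

/-- The product of `k` with the tangent vectors is `s κ ν`. -/
def kappa (s : ℝ) : ℝ := d.E * d.b₁ - (1 / 2) * d.E ^ 2 * (s * d.φ) * d.a₁

/-- The tangential part of the outgoing null normal `k + s² μ ℓ + …`, divided by `s ν`. -/
def outShift (s μ : ℝ) : ℝ := -(d.kappa s - s ^ 2 * μ * d.a₁) * d.Ri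

/-- The tangential part of the ingoing null normal `s² μ k + ℓ + …`, divided by `s ν`. -/
def inShift (s μ : ℝ) : ℝ := -(s ^ 2 * μ * d.kappa s - d.a₁) * d.Ri

/-- The null second fundamental form along the outgoing normal, divided by `s`. -/
def outForm (s μ : ℝ) (A B : Fin 2) : ℝ :=
  (1 / 2) * d.E ^ 2 * d.φ * d.covV s A B - d.E * d.covR s A B + s * μ * d.covV s A B
    - s * (2 * d.b₁ * d.outShift s μ * d.ν A * d.ν B)

/-- The null second fundamental form along the ingoing normal. -/
def inForm (s μ : ℝ) (A B : Fin 2) : ℝ :=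
  s ^ 2 * ((1 / 2) * d.E ^ 2 * (s * d.φ) * μ * d.covV s A B) - s ^ 2 * (d.E * μ * (s * d.covR s A B))
    + d.covV s A B - s ^ 2 * (2 * d.b₁ * d.inShift s μ * d.ν A * d.ν B)

/-- The Gram determinant of the first fundamental form. -/
def gramDet (s : ℝ) : ℝ := d.gram s 0 0 * d.gram s 1 1 - d.gram s 0 1 * d.gram s 1 0

/-- The trace of the form `K` in the induced metric, multiplied by the Gram determinant. -/
def traceNumer (s : ℝ) (K : Fin 2 → Fin 2 → ℝ) : ℝ :=
  d.gram s 1 1 * K 0 0 - d.gram s 0 1 * K 0 1 - d.gram s 1 0 * K 1 0 + d.gram s 0 0 * K 1 1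

/-- Half the coefficient of the linear term in the equations for the null normals. -/
def mid (s : ℝ) : ℝ := d.R ^ 2 + s ^ 2 * (d.kappa s * d.a₁ * d.nuSq)

/-- The bounds on local data under which the estimates are uniform. In the last one the bracket is
the Laplacian of `b` on the unit sphere and `φ R` is `(r - 2m) / s`; it makes the outgoing expansion
negative to first order in `s`. -/
structure Admissible (C ρ η : ℝ) : Prop where
  φ : |d.φ| ≤ C
  E : |d.E| ≤ C
  Ei : |d.Ei| ≤ C
  R : |d.R| ≤ C
  Ri : |d.Ri| ≤ C
  G : |d.G| ≤ C
  A : |d.A| ≤ C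
  Q : |d.Q| ≤ C
  br : |d.br| ≤ C
  a₁ : |d.a₁| ≤ C
  a₂ : |d.a₂| ≤ C
  b₁ : |d.b₁| ≤ C
  b₂ : |d.b₂| ≤ C
  t : |d.t| ≤ 1
  nuSq : d.nuSq = 1 - d.t ^ 2
  E_ge : ρ ≤ d.E
  R_ge : ρ ≤ d.R
  E_mul : d.E * d.Ei = 1
  R_mul : d.R * d.Ri = 1
  first_order : d.φ * d.R - (d.b₂ * (1 - d.t ^ 2) - 2 * d.b₁ * d.t) ≤ -η

/-- Local data listed as a vector. -/
def ofVec (x : Fin 16 → ℝ) : GraphData :=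
  ⟨x 0, x 1, x 2, x 3, x 4, x 5, x 6, x 7, x 8, x 9, x 10, x 11, x 12, x 13, ![x 14, x 15]⟩

/-- The inverse of `ofVec`. -/
def toVec : Fin 16 → ℝ :=
  ![d.φ, d.E, d.Ei, d.R, d.Ri, d.G, d.A, d.Q, d.br, d.a₁, d.a₂, d.b₁, d.b₂, d.t, d.ν 0, d.ν 1]

lemma ofVec_toVec : ofVec d.toVec = d := by
  obtain ⟨φ, E, Ei, R, Ri, G, A, Q, br, a₁, a₂, b₁, b₂, t, ν⟩ := d
  have : ![ν 0, ν 1] = ν := by funext A; fin_cases A <;> rfl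
  simp [ofVec, toVec, this]

lemma isCompact_admissible (C ρ η : ℝ) :
    IsCompact {x : Fin 16 → ℝ | (ofVec x).Admissible C ρ η} := by
  have hset : {x : Fin 16 → ℝ | (ofVec x).Admissible C ρ η} =
      {x | |x 0| ≤ C ∧ |x 1| ≤ C ∧ |x 2| ≤ C ∧ |x 3| ≤ C ∧ |x 4| ≤ C ∧ |x 5| ≤ C ∧ |x 6| ≤ C ∧
        |x 7| ≤ C ∧ |x 8| ≤ C ∧ |x 9| ≤ C ∧ |x 10| ≤ C ∧ |x 11| ≤ C ∧ |x 12| ≤ C ∧ |x 13| ≤ 1 ∧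
        x 14 ^ 2 + x 15 ^ 2 = 1 - x 13 ^ 2 ∧ ρ ≤ x 1 ∧ ρ ≤ x 3 ∧ x 1 * x 2 = 1 ∧ x 3 * x 4 = 1 ∧
        x 0 * x 3 - (x 12 * (1 - x 13 ^ 2) - 2 * x 11 * x 13) ≤ -η} := by
    ext x
    constructor
    · rintro ⟨h1, h2, h3, h4, h5, h6, h7, h8, h9, h10, h11, h12, h13, h14, h15, h16, h17, h18, h19,
        h20⟩
      exact ⟨h1, h2, h3, h4, h5, h6, h7, h8, h9, h10, h11, h12, h13, h14, h15, h16, h17, h18, h19,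
        h20⟩
    · rintro ⟨h1, h2, h3, h4, h5, h6, h7, h8, h9, h10, h11, h12, h13, h14, h15, h16, h17, h18, h19,
        h20⟩
      exact ⟨h1, h2, h3, h4, h5, h6, h7, h8, h9, h10, h11, h12, h13, h14, h15, h16, h17, h18, h19,
        h20⟩
  refine Metric.isCompact_of_isClosed_isBounded ?_ ?_
  · rw [hset]
    repeat' refine IsClosed.and ?_ ?_
    all_goals first
      | exact isClosed_le (by fun_prop) (by fun_prop)
      | exact isClosed_eq (by fun_prop) (by fun_prop)
  · refine (Metric.isBounded_closedBall (x := (0 : Fin 16 → ℝ)) (r := max C 1)).subset ?_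
    intro x hx
    rw [hset] at hx
    obtain ⟨h1, h2, h3, h4, h5, h6, h7, h8, h9, h10, h11, h12, h13, h14, h15, -⟩ := hx
    have hν0 : |x 14| ≤ 1 := abs_le_one_iff_mul_self_le_one.mpr (by nlinarith [sq_nonneg (x 15)])
    have hν1 : |x 15| ≤ 1 := abs_le_one_iff_mul_self_le_one.mpr (by nlinarith [sq_nonneg (x 14)])
    rw [mem_closedBall_zero_iff, pi_norm_le_iff_of_nonneg (le_max_of_le_right zero_le_one)]
    intro i
    fin_cases i <;> simp [*]

/-- A strict inequality that holds at `s = 0` for all admissible data and all `μ`, `μ'` in a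
bounded interval persists for small `s`. -/
lemma eventually_neg {C ρ η : ℝ} {F : ℝ → ℝ → ℝ → GraphData → ℝ}
    (hF : Continuous fun z : ℝ × (ℝ × ℝ × (Fin 16 → ℝ)) => F z.1 z.2.1 z.2.2.1 (ofVec z.2.2.2))
    (h₀ : ∀ μ μ' d, d.Admissible C ρ η → F 0 μ μ' d < 0) (B : ℝ) :
    ∀ᶠ s in nhds (0 : ℝ), ∀ μ ∈ Set.Icc 0 B, ∀ μ' ∈ Set.Icc 0 B, ∀ d : GraphData,
      d.Admissible C ρ η → F s μ μ' d < 0 := by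
  have hK : IsCompact (Set.Icc 0 B ×ˢ (Set.Icc 0 B ×ˢ
      {x : Fin 16 → ℝ | (ofVec x).Admissible C ρ η})) :=
    isCompact_Icc.prod (isCompact_Icc.prod (isCompact_admissible C ρ η))
  have h := hK.eventually_forall_of_forall_eventually (x₀ := (0 : ℝ))
    (P := fun s w => F s w.1 w.2.1 (ofVec w.2.2) < 0) ?_
  · filter_upwards [h] with s hs μ hμ μ' hμ' d hd
    have := hs (μ, μ', d.toVec) ⟨hμ, hμ', by rw [← ofVec_toVec d] at hd; exact hd⟩
    rwa [ofVec_toVec] at this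
  · rintro ⟨μ, μ', x⟩ ⟨-, -, hx⟩
    exact hF.continuousAt.eventually_lt continuousAt_const (h₀ μ μ' _ hx)

/-- The smaller root of a quadratic equation, which stays bounded as the leading coefficient tends
to zero. -/
lemma exists_root {a b c : ℝ} (hb : 0 < b) (hc : 0 ≤ c) (h : a * c ≤ b ^ 2) :
    ∃ x ∈ Set.Icc 0 (c / b), a * x ^ 2 - 2 * b * x + c = 0 := by
  have hcb : 0 ≤ c / b := div_nonneg hc hb.le
  have hcont : ContinuousOn (fun x : ℝ => a * x ^ 2 - 2 * b * x + c) (Set.Icc 0 (c / b)) := by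
    fun_prop
  have h1 : a * (c / b) ^ 2 - 2 * b * (c / b) + c ≤ 0 := by
    have e : a * (c / b) ^ 2 - 2 * b * (c / b) + c = c * (a * c - b ^ 2) / b ^ 2 := by
      field_simp; ring
    rw [e]
    exact div_nonpos_of_nonpos_of_nonneg (mul_nonpos_of_nonneg_of_nonpos hc (by linarith))
      (by positivity)
  obtain ⟨x, hx, hx0⟩ := intermediate_value_Icc' hcb hcont ⟨h1, by simpa using hc⟩
  exact ⟨x, hx, hx0⟩

lemma eventually_neg_of_data {C ρ η : ℝ} {F : ℝ → GraphData → ℝ}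
    (hF : Continuous fun z : ℝ × (Fin 16 → ℝ) => F z.1 (ofVec z.2))
    (h₀ : ∀ d, d.Admissible C ρ η → F 0 d < 0) :
    ∀ᶠ s in nhds (0 : ℝ), ∀ d : GraphData, d.Admissible C ρ η → F s d < 0 := by
  have h := eventually_neg (C := C) (ρ := ρ) (η := η) (F := fun s _ _ d => F s d)
    (hF.comp (continuous_fst.prodMk (continuous_snd.comp (continuous_snd.comp continuous_snd))))
    (fun _ _ => h₀) 0
  filter_upwards [h] with s hs d hd
  exact hs 0 (by simp) 0 (by simp) d hd

/-- The inequalities at one point that make the graph spacelike and trapped there, together with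
crude bounds on its area element; `μ` and `μ'` determine the two null normals. -/
structure IsTrappedAt (s μ μ' : ℝ) : Prop where
  nonneg : 0 ≤ μ
  nonneg' : 0 ≤ μ'
  null_out : s ^ 4 * d.a₁ ^ 2 * d.nuSq * μ ^ 2 - 2 * d.mid s * μ + d.kappa s ^ 2 * d.nuSq = 0
  null_in : s ^ 4 * d.kappa s ^ 2 * d.nuSq * μ' ^ 2 - 2 * d.mid s * μ' + d.a₁ ^ 2 * d.nuSq = 0
  gram_pos : 0 < d.gram s 0 0
  det_ge : d.R ^ 4 / 2 < d.gramDet s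
  det_le : d.gramDet s < 2 * d.R ^ 4
  out_neg : d.traceNumer s (d.outForm s μ) < 0
  in_neg : d.traceNumer s (d.inForm s μ') < 0
  dot_neg : -1 - s ^ 4 * (μ * μ') + s ^ 2 * (d.outShift s μ * d.inShift s μ' * d.nuSq) < 0

/-- For small `s` all admissible local data are trapped: at `s = 0` the required inequalities hold
strictly, the outgoing expansion having been divided by `s`. -/
lemma eventually_isTrappedAt {C ρ η : ℝ} (hρ : 0 < ρ) (hη : 0 < η) :
    ∀ᶠ s in nhds (0 : ℝ), ∀ d : GraphData, d.Admissible C ρ η → ∃ μ μ', d.IsTrappedAt s μ μ' := by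
  have hR {d : GraphData} (hd : d.Admissible C ρ η) : 0 < d.R := hρ.trans_le hd.R_ge
  have hmid0 (d : GraphData) : d.mid 0 = d.R ^ 2 := by simp [mid]
  have hgram0 (d : GraphData) (A B : Fin 2) : d.gram 0 A B = d.R ^ 2 * if A = B then 1 else 0 := by
    simp [gram]
  -- a bound for the roots of the two null equations
  set B : ℝ := (C ^ 2 * C ^ 2 + C ^ 2 + 1) / ρ ^ 2 with hB
  have hBρ : B * ρ ^ 2 = C ^ 2 * C ^ 2 + C ^ 2 + 1 := by rw [hB]; field_simp
  have hB0 : 0 ≤ B := by positivity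
  have hsq {x : ℝ} (hx : |x| ≤ C) : x ^ 2 ≤ C ^ 2 :=
    sq_le_sq' (by linarith [abs_le.mp hx]) (abs_le.mp hx).2
  have hnu {d : GraphData} (hd : d.Admissible C ρ η) : d.nuSq ≤ 1 := by
    rw [hd.nuSq]; nlinarith [sq_nonneg d.t]
  have hnu0 (d : GraphData) : 0 ≤ d.nuSq := by rw [nuSq]; positivity
  have e1 := eventually_neg_of_data (C := C) (ρ := ρ) (η := η) (F := fun s d => -d.mid s)
    (by simp only [mid, kappa, nuSq, ofVec]; fun_prop)
    (fun d hd => by have := hR hd; simp only [hmid0]; nlinarith)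
  have e2 := eventually_neg_of_data (C := C) (ρ := ρ) (η := η)
    (F := fun s d => s ^ 4 * d.a₁ ^ 2 * d.nuSq * (d.kappa s ^ 2 * d.nuSq) - d.mid s ^ 2)
    (by simp only [mid, kappa, nuSq, ofVec]; fun_prop)
    (fun d hd => by have := hR hd; simp only [hmid0]; norm_num; positivity)
  have e3 := eventually_neg_of_data (C := C) (ρ := ρ) (η := η)
    (F := fun s d => d.kappa s ^ 2 * d.nuSq - B * d.mid s)
    (by simp only [mid, kappa, nuSq, ofVec]; fun_prop)
    (fun d hd => by
      have h1 : d.kappa 0 ^ 2 = d.E ^ 2 * d.b₁ ^ 2 := by simp [kappa]; ring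
      have h2 : d.E ^ 2 * d.b₁ ^ 2 ≤ C ^ 2 * C ^ 2 :=
        mul_le_mul (hsq hd.E) (hsq hd.b₁) (sq_nonneg _) (sq_nonneg _)
      have h3 : d.E ^ 2 * d.b₁ ^ 2 * d.nuSq ≤ d.E ^ 2 * d.b₁ ^ 2 :=
        mul_le_of_le_one_right (by positivity) (hnu hd)
      have h4 : B * ρ ^ 2 ≤ B * d.R ^ 2 :=
        mul_le_mul_of_nonneg_left (pow_le_pow_left₀ hρ.le hd.R_ge 2) hB0
      simp only [hmid0, h1]
      nlinarith [sq_nonneg C])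
  have e4 := eventually_neg_of_data (C := C) (ρ := ρ) (η := η)
    (F := fun s d => d.a₁ ^ 2 * d.nuSq - B * d.mid s)
    (by simp only [mid, kappa, nuSq, ofVec]; fun_prop)
    (fun d hd => by
      have h2 := hsq hd.a₁
      have h3 : d.a₁ ^ 2 * d.nuSq ≤ d.a₁ ^ 2 := mul_le_of_le_one_right (by positivity) (hnu hd)
      have h4 : B * ρ ^ 2 ≤ B * d.R ^ 2 :=
        mul_le_mul_of_nonneg_left (pow_le_pow_left₀ hρ.le hd.R_ge 2) hB0
      simp only [hmid0]
      nlinarith [sq_nonneg (C ^ 2)])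
  have e5 := eventually_neg_of_data (C := C) (ρ := ρ) (η := η) (F := fun s d => -d.gram s 0 0)
    (by simp only [gram, ofVec]; fun_prop)
    (fun d hd => by have := hR hd; simp only [hgram0]; simp; positivity)
  have e6 := eventually_neg_of_data (C := C) (ρ := ρ) (η := η) (F := fun s d => d.R ^ 4 / 2 - d.gramDet s)
    (by simp only [gramDet, gram, ofVec]; fun_prop)
    (fun d hd => by
      have := pow_pos (hR hd) 4
      simp only [gramDet, hgram0]; norm_num; nlinarith)
  have e7 := eventually_neg_of_data (C := C) (ρ := ρ) (η := η) (F := fun s d => d.gramDet s - 2 * d.R ^ 4)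
    (by simp only [gramDet, gram, ofVec]; fun_prop)
    (fun d hd => by
      have := pow_pos (hR hd) 4
      simp only [gramDet, hgram0]; norm_num; nlinarith)
  have e8 := eventually_neg (C := C) (ρ := ρ) (η := η)
    (F := fun s μ _ d => d.traceNumer s (d.outForm s μ))
    (by simp only [traceNumer, outForm, outShift, covV, covR, kappa, gram, ofVec]; fun_prop)
    (fun μ _ d hd => by
      have hE : 0 < d.E := hρ.trans_le hd.E_ge
      have h1 : d.traceNumer 0 (d.outForm 0 μ)
          = d.R ^ 2 * d.E * (d.φ * d.R - (d.b₂ * (1 - d.t ^ 2) - 2 * d.b₁ * d.t)) := by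
        have hn := hd.nuSq
        rw [nuSq] at hn
        simp only [traceNumer, hgram0, outForm, covV, covR]
        norm_num
        linear_combination (-(d.R ^ 2 * d.E * d.b₂)) * hn - d.R ^ 3 * d.E * d.φ * hd.E_mul
      rw [h1]
      have := hR hd
      exact mul_neg_of_pos_of_neg (by positivity) (by linarith [hd.first_order])) B
  have e9 := eventually_neg (C := C) (ρ := ρ) (η := η)
    (F := fun s _ μ' d => d.traceNumer s (d.inForm s μ'))
    (by simp only [traceNumer, inForm, inShift, covV, covR, kappa, gram, ofVec]; fun_prop)
    (fun _ μ' d hd => by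
      have hE : 0 < d.E := hρ.trans_le hd.E_ge
      have hEi : 0 < d.Ei := (pos_iff_pos_of_mul_pos (by rw [hd.E_mul]; norm_num)).mp hE
      have h1 : d.traceNumer 0 (d.inForm 0 μ') = -(2 * d.Ei * d.R ^ 3) := by
        simp only [traceNumer, hgram0, inForm, covV, covR]
        norm_num
        ring
      have := hR hd
      rw [h1, neg_lt_zero]
      positivity) B
  have e10 := eventually_neg (C := C) (ρ := ρ) (η := η)
    (F := fun s μ μ' d => -1 - s ^ 4 * (μ * μ') + s ^ 2 * (d.outShift s μ * d.inShift s μ' * d.nuSq))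
    (by simp only [outShift, inShift, kappa, nuSq, ofVec]; fun_prop)
    (fun μ μ' d _ => by norm_num) B
  filter_upwards [e1, e2, e3, e4, e5, e6, e7, e8, e9, e10] with s h1 h2 h3 h4 h5 h6 h7 h8 h9 h10 d hd
  have hm : 0 < d.mid s := by linarith [h1 d hd]
  have hn := hnu0 d
  obtain ⟨μ, hμ, hμ0⟩ := exists_root (a := s ^ 4 * d.a₁ ^ 2 * d.nuSq) (b := d.mid s)
    (c := d.kappa s ^ 2 * d.nuSq) hm (by positivity) (by linarith [h2 d hd])
  obtain ⟨μ', hμ', hμ0'⟩ := exists_root (a := s ^ 4 * d.kappa s ^ 2 * d.nuSq) (b := d.mid s)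
    (c := d.a₁ ^ 2 * d.nuSq) hm (by positivity) (by
      have := h2 d hd
      calc _ = s ^ 4 * d.a₁ ^ 2 * d.nuSq * (d.kappa s ^ 2 * d.nuSq) := by ring
        _ ≤ _ := by linarith)
  have hμB : μ ∈ Set.Icc 0 B :=
    ⟨hμ.1, hμ.2.trans ((div_le_iff₀ hm).mpr (by linarith [h3 d hd]))⟩
  have hμB' : μ' ∈ Set.Icc 0 B :=
    ⟨hμ'.1, hμ'.2.trans ((div_le_iff₀ hm).mpr (by linarith [h4 d hd]))⟩
  exact ⟨μ, μ', hμ.1, hμ'.1, hμ0, hμ0', by linarith [h5 d hd], by linarith [h6 d hd],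
    by linarith [h7 d hd], h8 μ hμB μ' hμB' d hd, h9 μ hμB μ' hμB' d hd, h10 μ hμB μ' hμB' d hd⟩

end GraphData

/-! ### The fundamental forms and null normals of a graph -/

lemma posDef_fin_two {N : Matrix (Fin 2) (Fin 2) ℝ} (hs : N 0 1 = N 1 0) (h₀ : 0 < N 0 0)
    (hd : 0 < N.det) : N.PosDef := by
  rw [Matrix.det_fin_two] at hd
  refine Matrix.PosDef.of_dotProduct_mulVec_pos ?_ fun x hx => ?_
  · ext A B
    fin_cases A <;> fin_cases B <;> simp [Matrix.conjTranspose_apply, hs]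
  · have hsum : star x ⬝ᵥ (N.mulVec x)
        = N 0 0 * x 0 ^ 2 + (N 0 1 + N 1 0) * x 0 * x 1 + N 1 1 * x 1 ^ 2 := by
      simp [dotProduct, Matrix.mulVec, Fin.sum_univ_two]; ring
    rw [hsum]
    have hsq : N 0 0 * (N 0 0 * x 0 ^ 2 + (N 0 1 + N 1 0) * x 0 * x 1 + N 1 1 * x 1 ^ 2)
        = (N 0 0 * x 0 + N 0 1 * x 1) ^ 2 + (N 0 0 * N 1 1 - N 0 1 * N 1 0) * x 1 ^ 2 := by
      rw [hs]; ring
    refine (pos_iff_pos_of_mul_pos ?_).mp h₀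
    rw [hsq]
    by_cases h1 : x 1 = 0
    · have h0 : x 0 ≠ 0 := fun h0 => hx (by funext A; fin_cases A <;> simp [h0, h1])
      rw [h1]
      have : 0 < (N 0 0 * x 0) ^ 2 := by positivity
      simpa using this
    · have : 0 < (N 0 0 * N 1 1 - N 0 1 * N 1 0) * x 1 ^ 2 := by positivity
      nlinarith [sq_nonneg (N 0 0 * x 0 + N 0 1 * x 1)]

lemma sum_inv_fin_two (N K : Matrix (Fin 2) (Fin 2) ℝ) :
    ∑ A, ∑ B, N⁻¹ A B * K A B
      = (N 1 1 * K 0 0 - N 0 1 * K 0 1 - N 1 0 * K 1 0 + N 0 0 * K 1 1) / N.det := by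
  rw [Matrix.inv_def, Matrix.adjugate_fin_two]
  simp [Fin.sum_univ_two]
  ring

namespace SphericalSpacetime

variable {M : SphericalSpacetime}

/-- The local data of the graph `v = v₀ + s a`, `r = r₀ + s b` at a point where `v = v`, `r = r`. -/
def graphData (M : SphericalSpacetime) (s v r a₁ a₂ b₁ b₂ t : ℝ) (ν : Fin 2 → ℝ) : GraphData where
  φ := M.warp (v, r) / s
  E := Real.exp (M.β (v, r))
  Ei := (Real.exp (M.β (v, r)))⁻¹
  R := r
  Ri := r⁻¹
  G := M.coefG (v, r)
  A := M.coefA (v, r)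
  Q := M.coefQ (v, r)
  br := partialR M.β (v, r)
  a₁ := a₁
  a₂ := a₂
  b₁ := b₁
  b₂ := b₂
  t := t
  ν := ν

/-- The pointwise content of being a trapped surface. -/
structure IsTrappedPoint (M : SphericalSpacetime) (Φ : S2 → Pt) (q : S2) : Prop where
  spacelike : (M.metric.firstForm Φ q).PosDef
  trapped : ∃ kp km : Pt,
    M.IsFutureNullNormal Φ q kp ∧ M.IsFutureNullNormal Φ q km ∧
    M.metric.dot (Φ q) kp km = -1 ∧
    M.metric.expansion Φ q kp < 0 ∧ M.metric.expansion Φ q km < 0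

lemma dot_smul_left (p : Pt) (c : ℝ) (X Y : Pt) :
    M.metric.dot p (c • X) Y = c * M.metric.dot p X Y := by
  simp only [MetricField.dot, Finset.mul_sum, Pi.smul_apply, smul_eq_mul]
  exact Finset.sum_congr rfl fun μ _ => Finset.sum_congr rfl fun ν _ => by ring

lemma dot_smul_right (p : Pt) (c : ℝ) (X Y : Pt) :
    M.metric.dot p X (c • Y) = c * M.metric.dot p X Y := by
  simp only [MetricField.dot, Finset.mul_sum, Pi.smul_apply, smul_eq_mul]
  exact Finset.sum_congr rfl fun μ _ => Finset.sum_congr rfl fun ν _ => by ring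

lemma expansion_smul (Φ : S2 → Pt) (q : S2) (c : ℝ) (k : Pt) :
    M.metric.expansion Φ q (c • k) = c * M.metric.expansion Φ q k := by
  simp only [MetricField.expansion, MetricField.nullForm, dot_smul_left, Finset.mul_sum]
  exact Finset.sum_congr rfl fun μ _ => Finset.sum_congr rfl fun ν _ => by ring

lemma IsFutureNullNormal.smul {Φ : S2 → Pt} {q : S2} {k : Pt} (hk : M.IsFutureNullNormal Φ q k)
    {c : ℝ} (hc : 0 < c) : M.IsFutureNullNormal Φ q (c • k) := by
  obtain ⟨⟨-, h2⟩, h3, h4⟩ := hk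
  refine ⟨⟨?_, ?_⟩, ?_, fun A => ?_⟩
  · rw [dot_smul_left, dot_smul_right, h3]; simp
  · rw [dot_smul_left]; exact mul_neg_of_pos_of_neg hc h2
  · rw [dot_smul_left, dot_smul_right, h3]; simp
  · rw [dot_smul_left, h4, mul_zero]

/-- Two future null normals with negative expansions can be rescaled to satisfy `g(k⁺, k⁻) = -1`. -/
lemma IsTrappedPoint.of_normals {Φ : S2 → Pt} {q : S2}
    (hs : (M.metric.firstForm Φ q).PosDef) {kp km : Pt} (hp : M.IsFutureNullNormal Φ q kp)
    (hm : M.IsFutureNullNormal Φ q km) (hdot : M.metric.dot (Φ q) kp km < 0)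
    (hθp : M.metric.expansion Φ q kp < 0) (hθm : M.metric.expansion Φ q km < 0) :
    M.IsTrappedPoint Φ q := by
  have hc : 0 < (-M.metric.dot (Φ q) kp km)⁻¹ := inv_pos.mpr (by linarith)
  refine ⟨hs, kp, (-M.metric.dot (Φ q) kp km)⁻¹ • km, hp, hm.smul hc, ?_, hθp, ?_⟩
  · rw [dot_smul_right]
    have := hdot.ne
    field_simp
  · rw [expansion_smul]; exact mul_neg_of_pos_of_neg hc hθm

lemma covDeriv_frameVec {Φ : S2 → Pt} {q : S2} {v r : ℝ} (hz : (v, r) ∈ M.dom)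
    (hΦ : Φ q = Fin.cons v fun j => r * (q : EuclideanSpace ℝ (Fin 3)) j)
    {U : Fin 2 → Fin 3 → ℝ} (hU : IsFrame q U) {A B : Fin 2} {x₀ x₁ y₀ y₁ w₀ w₁ : ℝ}
    {x y w : Fin 2 → ℝ} (hA : tangentVec Φ q A = frameVec q U x₀ x₁ x)
    (hB : tangentVec Φ q B = frameVec q U y₀ y₁ y)
    (hAB : secondDeriv Φ q A B = frameVec q U w₀ w₁ w) :
    M.metric.covDeriv Φ q A B = frameVec q U
      (w₀ + (M.coefG (v, r) * x₀ * y₀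
          - (Real.exp (M.β (v, r)))⁻¹ * (x 0 * y 0 + x 1 * y 1) / r))
      (w₁ + (M.coefA (v, r) * x₀ * y₀ - M.coefQ (v, r) * (x₀ * y₁ + x₁ * y₀)
          + partialR M.β (v, r) * x₁ * y₁
          + (1 - M.warp (v, r)) * (x 0 * y 0 + x 1 * y 1) / r)) w := by
  have h := sum_christoffel_frameVec hz hU x₀ x₁ y₀ y₁ x y
  have h2 : M.metric.covDeriv Φ q A B = secondDeriv Φ q A B + fun μ => ∑ ν, ∑ ρ,
      M.metric.christoffel (Φ q) μ ν ρ * tangentVec Φ q A ν * tangentVec Φ q B ρ := rfl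
  rw [h2, hA, hB, hAB, hΦ, h, frameVec_add, add_zero]

/-- The surface `Φ` is at `q`, in the orthonormal frame `U`, the graph with the local data `d`. -/
structure IsGraphAt (M : SphericalSpacetime) (Φ : S2 → Pt) (q : S2) (U : Fin 2 → Fin 3 → ℝ)
    (s v r : ℝ) (d : GraphData) : Prop where
  frame : IsFrame q U
  mem_dom : (v, r) ∈ M.dom
  point : Φ q = Fin.cons v fun j => r * (q : EuclideanSpace ℝ (Fin 3)) j
  warp : M.warp (v, r) = s * d.φ
  exp : Real.exp (M.β (v, r)) = d.E
  exp_inv : (Real.exp (M.β (v, r)))⁻¹ = d.Ei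
  radius : r = d.R
  radius_inv : r⁻¹ = d.Ri
  coefG : M.coefG (v, r) = d.G
  coefA : M.coefA (v, r) = d.A
  coefQ : M.coefQ (v, r) = d.Q
  partialR : partialR M.β (v, r) = d.br
  tangentVec : ∀ A, tangentVec Φ q A = frameVec q U (s * d.a₁ * d.ν A) (s * d.b₁ * d.ν A)
    fun C => if C = A then d.R else 0
  secondDeriv : ∀ A B, secondDeriv Φ q A B = frameVec q U
    (s * d.a₂ * d.ν A * d.ν B - s * d.a₁ * if A = B then d.t else 0)
    (s * d.b₂ * d.ν A * d.ν B - s * d.b₁ * (if A = B then d.t else 0) - if A = B then d.R else 0)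
    (fun C => (if C = B then s * d.b₁ * d.ν A else 0) + if C = A then s * d.b₁ * d.ν B else 0)

namespace IsGraphAt

variable {Φ : S2 → Pt} {q : S2} {U : Fin 2 → Fin 3 → ℝ} {s v r : ℝ} {d : GraphData}

lemma radius_pos (h : M.IsGraphAt Φ q U s v r d) : 0 < d.R := by
  rw [← h.radius]; exact M.pos_of_mem _ h.mem_dom

lemma E_mul (h : M.IsGraphAt Φ q U s v r d) : d.E * d.Ei = 1 := by
  rw [← h.exp, ← h.exp_inv]; exact mul_inv_cancel₀ (Real.exp_pos _).ne'

lemma R_mul (h : M.IsGraphAt Φ q U s v r d) : d.R * d.Ri = 1 := by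
  rw [← h.radius, ← h.radius_inv]; exact mul_inv_cancel₀ (M.pos_of_mem _ h.mem_dom).ne'

lemma dot_eq (h : M.IsGraphAt Φ q U s v r d) (x₀ x₁ y₀ y₁ : ℝ) (x y : Fin 2 → ℝ) :
    M.metric.dot (Φ q) (frameVec q U x₀ x₁ x) (frameVec q U y₀ y₁ y)
      = -(d.E ^ 2 * (s * d.φ)) * x₀ * y₀ + d.E * (x₀ * y₁ + x₁ * y₀) + (x 0 * y 0 + x 1 * y 1) := by
  rw [h.point, dot_frameVec (M.pos_of_mem _ h.mem_dom) h.frame, h.exp, h.warp]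

lemma firstForm_eq (h : M.IsGraphAt Φ q U s v r d) (A B : Fin 2) :
    M.metric.firstForm Φ q A B = d.gram s A B := by
  rw [MetricField.firstForm, Matrix.of_apply, h.tangentVec, h.tangentVec, h.dot_eq, GraphData.gram]
  fin_cases A <;> fin_cases B <;> simp <;> ring

lemma det_firstForm (h : M.IsGraphAt Φ q U s v r d) :
    (M.metric.firstForm Φ q).det = d.gramDet s := by
  rw [Matrix.det_fin_two]; simp only [h.firstForm_eq]; rfl

lemma covDeriv_eq (h : M.IsGraphAt Φ q U s v r d) (A B : Fin 2) :
    M.metric.covDeriv Φ q A B = frameVec q U (d.covV s A B) (s * d.covR s A B)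
      (fun C => (if C = B then s * d.b₁ * d.ν A else 0)
        + if C = A then s * d.b₁ * d.ν B else 0) := by
  rw [covDeriv_frameVec h.mem_dom h.point h.frame (h.tangentVec A) (h.tangentVec B)
    (h.secondDeriv A B), div_eq_mul_inv, div_eq_mul_inv, h.radius_inv, h.exp_inv, h.warp, h.coefG,
    h.coefA, h.coefQ, h.partialR]
  have hR := h.R_mul
  congr 1
  · rw [GraphData.covV]
    fin_cases A <;> fin_cases B <;> simp
    · linear_combination (-d.Ei * d.R) * hR
    · ring
    · ring
    · linear_combination (-d.Ei * d.R) * hR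
  · rw [GraphData.covR]
    fin_cases A <;> fin_cases B <;> simp
    · linear_combination ((1 - s * d.φ) * d.R) * hR
    · ring
    · ring
    · linear_combination ((1 - s * d.φ) * d.R) * hR

/-- The null normals: `α` and `l` are the components along `k` and `ℓ`, the tangential part `s χ ν`
is determined by orthogonality to the surface, and the last hypothesis says that the length is
zero. -/
lemma isFutureNullNormal (h : M.IsGraphAt Φ q U s v r d) {α l χ : ℝ}
    (hαl : 0 < α + l) (hχ : χ = -(α * d.kappa s - l * d.a₁) * d.Ri)
    (hnull : 2 * α * l = s ^ 2 * χ ^ 2 * d.nuSq) :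
    M.IsFutureNullNormal Φ q (frameVec q U α ((1 / 2) * (s * d.φ) * d.E * α - d.Ei * l)
      (fun C => s * χ * d.ν C)) := by
  have hE := h.E_mul
  have hR := h.R_mul
  have h0 : M.metric.dot (Φ q) (frameVec q U α ((1 / 2) * (s * d.φ) * d.E * α - d.Ei * l)
      (fun C => s * χ * d.ν C)) (frameVec q U α ((1 / 2) * (s * d.φ) * d.E * α - d.Ei * l)
      (fun C => s * χ * d.ν C)) = 0 := by
    rw [h.dot_eq]
    rw [GraphData.nuSq] at hnull
    linear_combination (-2 * α * l) * hE - hnull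
  refine ⟨⟨h0.le, ?_⟩, h0, fun A => ?_⟩
  · have hk := kay_add_ell_cons (M := M) (v := v) (M.pos_of_mem _ h.mem_dom) q U
    rw [← h.point] at hk
    rw [hk, h.dot_eq, h.exp_inv, h.warp, h.exp]
    simp only [Pi.zero_apply]
    have : -(d.E ^ 2 * (s * d.φ)) * α * 1 + d.E * (α * (1 / 2 * (s * d.φ) * d.E - d.Ei)
        + (1 / 2 * (s * d.φ) * d.E * α - d.Ei * l) * 1) + (s * χ * d.ν 0 * 0 + s * χ * d.ν 1 * 0)
        = -(α + l) := by
      linear_combination (-α - l) * hE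
    rw [this]
    linarith
  · rw [h.tangentVec, h.dot_eq, hχ, GraphData.kappa]
    fin_cases A <;> simp
    · linear_combination (-l * s * d.a₁ * d.ν 0) * hE
        - (α * (d.E * d.b₁ - 1 / 2 * d.E ^ 2 * (s * d.φ) * d.a₁) - l * d.a₁) * s * d.ν 0 * hR
    · linear_combination (-l * s * d.a₁ * d.ν 1) * hE
        - (α * (d.E * d.b₁ - 1 / 2 * d.E ^ 2 * (s * d.φ) * d.a₁) - l * d.a₁) * s * d.ν 1 * hR

lemma expansion_eq (h : M.IsGraphAt Φ q U s v r d) (k : Pt) :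
    M.metric.expansion Φ q k
      = d.traceNumer s (M.metric.nullForm Φ q k) / d.gramDet s := by
  have h2 := sum_inv_fin_two (M.metric.firstForm Φ q) (Matrix.of (M.metric.nullForm Φ q k))
  simp only [Matrix.of_apply] at h2
  rw [MetricField.expansion, h2, h.det_firstForm]
  simp only [h.firstForm_eq]
  rfl

lemma nullForm_out (h : M.IsGraphAt Φ q U s v r d) (μ : ℝ) (A B : Fin 2) :
    M.metric.nullForm Φ q (frameVec q U 1 ((1 / 2) * (s * d.φ) * d.E * 1 - d.Ei * (s ^ 2 * μ))
      (fun C => s * d.outShift s μ * d.ν C)) A B = s * d.outForm s μ A B := by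
  have hE := h.E_mul
  rw [MetricField.nullForm, h.covDeriv_eq, h.dot_eq, GraphData.outForm]
  fin_cases A <;> fin_cases B <;> simp
  · linear_combination (s ^ 2 * μ * d.covV s 0 0) * hE
  · linear_combination (s ^ 2 * μ * d.covV s 0 1) * hE
  · linear_combination (s ^ 2 * μ * d.covV s 1 0) * hE
  · linear_combination (s ^ 2 * μ * d.covV s 1 1) * hE

lemma nullForm_in (h : M.IsGraphAt Φ q U s v r d) (μ : ℝ) (A B : Fin 2) :
    M.metric.nullForm Φ q (frameVec q U (s ^ 2 * μ)
      ((1 / 2) * (s * d.φ) * d.E * (s ^ 2 * μ) - d.Ei * 1)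
      (fun C => s * d.inShift s μ * d.ν C)) A B = d.inForm s μ A B := by
  have hE := h.E_mul
  rw [MetricField.nullForm, h.covDeriv_eq, h.dot_eq, GraphData.inForm]
  fin_cases A <;> fin_cases B <;> simp
  · linear_combination (d.covV s 0 0) * hE
  · linear_combination (d.covV s 0 1) * hE
  · linear_combination (d.covV s 1 0) * hE
  · linear_combination (d.covV s 1 1) * hE

lemma isTrappedPoint (h : M.IsGraphAt Φ q U s v r d) (hs : 0 < s) {μ μ' : ℝ}
    (ht : d.IsTrappedAt s μ μ') : M.IsTrappedPoint Φ q := by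
  have hR := h.R_mul
  have hE := h.E_mul
  have hdet : 0 < d.gramDet s := by
    have := pow_pos h.radius_pos 4
    linarith [ht.det_ge]
  refine IsTrappedPoint.of_normals ?_
    (h.isFutureNullNormal (α := 1) (l := s ^ 2 * μ) (χ := d.outShift s μ) (by nlinarith [ht.nonneg, sq_nonneg s])
      (by rw [GraphData.outShift]; ring) ?_)
    (h.isFutureNullNormal (α := s ^ 2 * μ') (l := 1) (χ := d.inShift s μ')
      (by nlinarith [ht.nonneg', sq_nonneg s])
      (by rw [GraphData.inShift]; ring) ?_) ?_ ?_ ?_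
  · refine posDef_fin_two ?_ ?_ ?_
    · rw [h.firstForm_eq, h.firstForm_eq, GraphData.gram, GraphData.gram]; simp; ring
    · rw [h.firstForm_eq]; exact ht.gram_pos
    · rw [h.det_firstForm]; exact hdet
  · have hn := ht.null_out
    rw [GraphData.mid] at hn
    rw [GraphData.outShift]
    linear_combination (-s ^ 2 * d.Ri ^ 2) * hn - 2 * s ^ 2 * μ * (d.R * d.Ri + 1) * hR
  · have hn := ht.null_in
    rw [GraphData.mid] at hn
    rw [GraphData.inShift]
    linear_combination (-s ^ 2 * d.Ri ^ 2) * hn - 2 * s ^ 2 * μ' * (d.R * d.Ri + 1) * hR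
  · have hd := ht.dot_neg
    rw [GraphData.nuSq] at hd
    rw [h.dot_eq]
    refine lt_of_eq_of_lt ?_ hd
    linear_combination (-1 - s ^ 4 * (μ * μ')) * hE
  · rw [h.expansion_eq]
    refine div_neg_of_neg_of_pos ?_ hdet
    have : d.traceNumer s (M.metric.nullForm Φ q (frameVec q U 1
        ((1 / 2) * (s * d.φ) * d.E * 1 - d.Ei * (s ^ 2 * μ))
        (fun C => s * d.outShift s μ * d.ν C))) = s * d.traceNumer s (d.outForm s μ) := by
      simp only [GraphData.traceNumer, h.nullForm_out]; ring
    rw [this]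
    exact mul_neg_of_pos_of_neg hs ht.out_neg
  · rw [h.expansion_eq]
    refine div_neg_of_neg_of_pos ?_ hdet
    have : d.traceNumer s (M.metric.nullForm Φ q (frameVec q U (s ^ 2 * μ')
        ((1 / 2) * (s * d.φ) * d.E * (s ^ 2 * μ') - d.Ei * 1)
        (fun C => s * d.inShift s μ' * d.ν C))) = d.traceNumer s (d.inForm s μ') := by
      simp only [GraphData.traceNumer, h.nullForm_in]
    rw [this]
    exact ht.in_neg

end IsGraphAt

/-- At each point of the graph `v = v₀ + s a`, `r = r₀ + s b`, some choice of `ν` completes the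
local data. -/
lemma exists_isGraphAt (n q : S2) {a b : ℝ → ℝ} {v₀ r₀ s : ℝ} (hs : 0 < s)
    (ha : ContDiffAt ℝ 2 a (height n q)) (hb : ContDiffAt ℝ 2 b (height n q))
    (hz : (v₀ + s * a (height n q), r₀ + s * b (height n q)) ∈ M.dom) :
    ∃ (U : Fin 2 → Fin 3 → ℝ) (ν : Fin 2 → ℝ), ν 0 ^ 2 + ν 1 ^ 2 = 1 - height n q ^ 2 ∧
      M.IsGraphAt (graphSphere n (fun t => v₀ + s * a t) fun t => r₀ + s * b t) q U s
        (v₀ + s * a (height n q)) (r₀ + s * b (height n q))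
        (M.graphData s (v₀ + s * a (height n q)) (r₀ + s * b (height n q))
          (deriv a (height n q)) (deriv (deriv a) (height n q))
          (deriv b (height n q)) (deriv (deriv b) (height n q)) (height n q) ν) := by
  obtain ⟨U, ν, hU, hν, htan, hsec⟩ := exists_frame_graphSphere n q
    (V := fun t => v₀ + s * a t) (R := fun t => r₀ + s * b t)
    (contDiffAt_const.add (contDiffAt_const.mul ha)) (contDiffAt_const.add (contDiffAt_const.mul hb))
  have hderiv (c : ℝ) (f : ℝ → ℝ) : deriv (fun t => c + s * f t) = fun t => s * deriv f t := by
    funext t; rw [deriv_const_add, deriv_const_mul_field]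
  have hderiv2 (f : ℝ → ℝ) : deriv (fun t => s * deriv f t) = fun t => s * deriv (deriv f) t := by
    funext t; rw [deriv_const_mul_field]
  simp only [hderiv, hderiv2] at htan hsec
  refine ⟨U, ν, hν, hU, hz, rfl, ?_, rfl, rfl, rfl, rfl, rfl, rfl, rfl, rfl, htan, hsec⟩
  simp only [graphData]
  field_simp

end SphericalSpacetime

/-! ### Small caps of the sphere -/

lemma dist_sq_eq_height (n q : S2) : dist q n ^ 2 = 2 - 2 * height n q := by
  have h1 := sum_coord_sq n
  have h2 := sum_coord_sq q
  rw [Subtype.dist_eq, EuclideanSpace.dist_eq, Real.sq_sqrt (by positivity)]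
  simp only [Real.dist_eq, sq_abs, height, Fin.sum_univ_three] at *
  linear_combination h1 + h2

lemma height_self (n : S2) : height n n = 1 := by
  have := dist_sq_eq_height n n
  rw [dist_self] at this
  linarith

lemma height_neg_self (n : S2) : height n (-n) = -1 := by
  have h := height_self n
  have hneg (j : Fin 3) : ((-n : S2) : EuclideanSpace ℝ (Fin 3)) j
      = -(n : EuclideanSpace ℝ (Fin 3)) j := rfl
  simp only [height, hneg, mul_neg, Finset.sum_neg_distrib] at h ⊢
  linarith

lemma continuous_height (n : EuclideanSpace ℝ (Fin 3)) : Continuous (height n) := by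
  unfold height
  fun_prop

/-- The area measure of the unit sphere. -/
abbrev sphereArea : Measure S2 := (volume : Measure (EuclideanSpace ℝ (Fin 3))).toSphere

open scoped Pointwise in
lemma sphereArea_singleton (n : S2) : sphereArea {n} = 0 := by
  rw [sphereArea, Measure.toSphere_apply' _ (measurableSet_singleton n)]
  have hnull : (volume : Measure (EuclideanSpace ℝ (Fin 3)))
      (Submodule.span ℝ {(n : EuclideanSpace ℝ (Fin 3))}) = 0 := by
    refine Measure.addHaar_submodule _ _ fun htop => ?_
    have h1 := finrank_span_singleton (K := ℝ) (ne_zero_of_mem_unit_sphere n)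
    rw [htop, finrank_top, finrank_euclideanSpace_fin] at h1
    norm_num at h1
  have hsub : Set.Ioo (0 : ℝ) 1 • ((Subtype.val : S2 → EuclideanSpace ℝ (Fin 3)) '' {n})
      ⊆ (Submodule.span ℝ {(n : EuclideanSpace ℝ (Fin 3))} : Set (EuclideanSpace ℝ (Fin 3))) := by
    rintro _ ⟨c, -, _, ⟨_, rfl, rfl⟩, rfl⟩
    exact Submodule.smul_mem _ _ (Submodule.mem_span_singleton_self _)
  rw [measure_mono_null hsub hnull, mul_zero]

lemma sphereArea_univ_ne_zero : sphereArea Set.univ ≠ 0 := by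
  rw [Measure.measure_univ_ne_zero]
  exact Measure.toSphere_ne_zero _

/-- Caps around `n` shrink to `n`, and their area tends to zero. -/
lemma exists_cap (n : S2) {O : Set S2} (hO : O ∈ nhds n) {κ : ENNReal} (hκ : κ ≠ 0) :
    ∃ δ, 0 < δ ∧ δ ≤ 1 ∧ {q | 1 - δ ≤ height n q} ⊆ O ∧
      sphereArea {q | 1 - δ ≤ height n q} < κ := by
  obtain ⟨O', hO', hopen, hlt⟩ := Set.exists_isOpen_lt_of_lt {n} κ
    (by rw [sphereArea_singleton]; exact pos_iff_ne_zero.mpr hκ : sphereArea {n} < κ)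
  obtain ⟨e, he, hball⟩ := Metric.mem_nhds_iff.mp
    (Filter.inter_mem hO (hopen.mem_nhds (hO' (Set.mem_singleton n))))
  have hsub : {q | 1 - min 1 (e ^ 2 / 4) ≤ height n q} ⊆ O ∩ O' := by
    intro q hq
    refine hball ?_
    have h := dist_sq_eq_height n q
    have h2 : min 1 (e ^ 2 / 4) ≤ e ^ 2 / 4 := min_le_right _ _
    rw [Set.mem_ofPred_eq] at hq
    rw [Metric.mem_ball]
    refine lt_of_pow_lt_pow_left₀ 2 he.le ?_
    nlinarith
  exact ⟨min 1 (e ^ 2 / 4), lt_min one_pos (by positivity), min_le_left _ _,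
    hsub.trans Set.inter_subset_left,
    (measure_mono (hsub.trans Set.inter_subset_right)).trans_lt hlt⟩

/-! ### The profile of the deformation -/

/-- There is an axisymmetric function `b` on the sphere whose Laplacian `u` is bounded below off
the cap `1 - δ < t` and negative at its centre. With `A² = 1 + δ²/2` one can take
`b = -log (A - t)`, for which `u = 1 - (A² - 1) / (A - t)²`. -/
lemma exists_profile {δ : ℝ} (hδ : 0 < δ) : ∃ b u : ℝ → ℝ,
    (∀ t ≤ 1, ContDiffAt ℝ 3 b t) ∧ (∀ t ≤ 1, ContDiffAt ℝ 3 u t) ∧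
    (∀ t ≤ 1, deriv (deriv b) t * (1 - t ^ 2) - 2 * deriv b t * t = u t) ∧
    (∀ t ≤ 1 - δ, 1 / 2 ≤ u t) ∧ u 1 < 0 := by
  set A := Real.sqrt (1 + δ ^ 2 / 2) with hA
  have hA2 : A ^ 2 = 1 + δ ^ 2 / 2 := Real.sq_sqrt (by positivity)
  have hA0 : 0 ≤ A := Real.sqrt_nonneg _
  have hA1 : 1 < A := by nlinarith [sq_pos_of_pos hδ]
  have hd1 {t : ℝ} (ht : t < A) : HasDerivAt (fun t => -Real.log (A - t)) ((A - t)⁻¹) t := by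
    have h : HasDerivAt (fun t => A - t) (-1) t := by
      simpa using (hasDerivAt_id t).const_sub A
    refine (h.log (by linarith : A - t ≠ 0)).fun_neg.congr_deriv ?_
    ring
  have hd2 {t : ℝ} (ht : t < A) : HasDerivAt (fun t => (A - t)⁻¹) (((A - t) ^ 2)⁻¹) t := by
    have h : HasDerivAt (fun t => A - t) (-1) t := by
      simpa using (hasDerivAt_id t).const_sub A
    refine (h.fun_inv (by linarith : A - t ≠ 0)).congr_deriv ?_
    ring
  refine ⟨fun t => -Real.log (A - t), fun t => 1 - δ ^ 2 / 2 / (A - t) ^ 2, fun t ht => ?_,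
    fun t ht => ?_, fun t ht => ?_, fun t ht => ?_, ?_⟩
  · exact ((contDiffAt_const.sub contDiffAt_id).log (by simp; linarith)).neg
  · refine contDiffAt_const.sub (contDiffAt_const.div ((contDiffAt_const.sub contDiffAt_id).pow 2) ?_)
    have : A - t ≠ 0 := by linarith
    simpa using this
  · have htA : t < A := by linarith
    have hev : deriv (fun t => -Real.log (A - t)) =ᶠ[nhds t] fun t => (A - t)⁻¹ := by
      filter_upwards [Iio_mem_nhds htA] with x hx
      exact (hd1 hx).deriv
    rw [hev.deriv_eq, (hd2 htA).deriv, (hd1 htA).deriv]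
    have : A - t ≠ 0 := by linarith
    field_simp
    linear_combination -2 * hA2
  · have h1 : δ ≤ A - t := by linarith
    have h2 : δ ^ 2 / 2 / (A - t) ^ 2 ≤ 1 / 2 := by
      have : 0 < A - t := by linarith
      rw [div_le_iff₀ (by positivity)]
      nlinarith
    linarith
  · have h1 : 0 < A - 1 := by linarith
    rw [sub_neg, lt_div_iff₀ (by positivity)]
    nlinarith

/-! ### Small deformations of a round sphere -/

lemma contDiffAt_deriv {f : ℝ → ℝ} {t : ℝ} {k m : WithTop ℕ∞} (hf : ContDiffAt ℝ k f t)
    (h : m + 1 ≤ k) : ContDiffAt ℝ m (deriv f) t :=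
  (hf.fderiv_right h).clm_apply contDiffAt_const

lemma contMDiff_graphSphere (n : S2) {V R : ℝ → ℝ}
    (hV : ∀ t ∈ Set.Icc (-1 : ℝ) 1, ContDiffAt ℝ 3 V t)
    (hR : ∀ t ∈ Set.Icc (-1 : ℝ) 1, ContDiffAt ℝ 3 R t) :
    ContMDiff (𝓡 2) 𝓘(ℝ, Pt) 3 (graphSphere n V R) := by
  have hcoord (j : Fin 3) : ContDiff ℝ 3 fun x : EuclideanSpace ℝ (Fin 3) => x j := by fun_prop
  have hh : ContDiff ℝ 3 fun x : EuclideanSpace ℝ (Fin 3) =>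
      ∑ j, (n : EuclideanSpace ℝ (Fin 3)) j * x j :=
    ContDiff.sum fun j _ => contDiff_const.mul (hcoord j)
  have hmem (q : S2) : height n q ∈ Set.Icc (-1 : ℝ) 1 :=
    height_mem_Icc n q
  have hcomp {f : ℝ → ℝ} (hf : ∀ t ∈ Set.Icc (-1 : ℝ) 1, ContDiffAt ℝ 3 f t) (q : S2) :
      ContDiffAt ℝ 3 (fun x : EuclideanSpace ℝ (Fin 3) =>
        f (∑ j, (n : EuclideanSpace ℝ (Fin 3)) j * x j)) q :=
    ContDiffAt.comp (q : EuclideanSpace ℝ (Fin 3)) (g := f)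
      (f := fun x : EuclideanSpace ℝ (Fin 3) => ∑ j, (n : EuclideanSpace ℝ (Fin 3)) j * x j)
      (hf _ (hmem q)) hh.contDiffAt
  rw [contMDiff_pi_space]
  intro μ q
  refine Fin.cases ?_ (fun j => ?_) μ
  · exact (hcomp hV q).contMDiffAt.comp q (contMDiff_coe_sphere q)
  · exact ((hcomp hR q).mul (hcoord j).contDiffAt).contMDiffAt.comp q (contMDiff_coe_sphere q)

lemma exists_forall_abs_le {f : ℝ → ℝ} (hf : ContinuousOn f (Set.Icc (-1 : ℝ) 1)) :
    ∃ C, 0 ≤ C ∧ ∀ t ∈ Set.Icc (-1 : ℝ) 1, |f t| ≤ C := by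
  obtain ⟨C, hC⟩ := isCompact_Icc.exists_bound_of_continuousOn hf
  exact ⟨max C 0, le_max_right _ _, fun t ht => (hC t ht).trans (le_max_left _ _)⟩

/-- Uniform convergence to the undeformed values. -/
lemma eventually_forall_deformed {N : Set (ℝ × ℝ)} {z₀ : ℝ × ℝ} (hN : N ∈ nhds z₀) {a b : ℝ → ℝ}
    (ha : ContinuousOn a (Set.Icc (-1 : ℝ) 1)) (hb : ContinuousOn b (Set.Icc (-1 : ℝ) 1)) :
    ∀ᶠ s in nhds (0 : ℝ), ∀ t ∈ Set.Icc (-1 : ℝ) 1, (z₀.1 + s * a t, z₀.2 + s * b t) ∈ N := by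
  obtain ⟨Ca, hCa0, hCa⟩ := exists_forall_abs_le ha
  obtain ⟨Cb, hCb0, hCb⟩ := exists_forall_abs_le hb
  obtain ⟨e, he, hball⟩ := Metric.mem_nhds_iff.mp hN
  have hs : ∀ᶠ s in nhds (0 : ℝ), |s| * (Ca + Cb + 1) < e := by
    have : Filter.Tendsto (fun s : ℝ => |s| * (Ca + Cb + 1)) (nhds 0) (nhds (|0| * (Ca + Cb + 1))) :=
      (continuous_abs.mul continuous_const).tendsto 0
    rw [abs_zero, zero_mul] at this
    exact this.eventually_lt_const he
  filter_upwards [hs] with s hs t ht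
  refine hball ?_
  rw [Metric.mem_ball, Prod.dist_eq, Real.dist_eq, Real.dist_eq, add_sub_cancel_left,
    add_sub_cancel_left, abs_mul, abs_mul]
  have h1 := hCa t ht
  have h2 := hCb t ht
  have h3 := abs_nonneg s
  exact max_lt (by nlinarith) (by nlinarith)

/-- Uniform first-order expansion of a differentiable function along a deformation. -/
lemma eventually_forall_first_order {F : ℝ × ℝ → ℝ} {z₀ : ℝ × ℝ} (hF : DifferentiableAt ℝ F z₀)
    {a b : ℝ → ℝ} (ha : ContinuousOn a (Set.Icc (-1 : ℝ) 1))
    (hb : ContinuousOn b (Set.Icc (-1 : ℝ) 1)) {η : ℝ} (hη : 0 < η) :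
    ∀ᶠ s in nhdsWithin (0 : ℝ) (Set.Ioi 0), ∀ t ∈ Set.Icc (-1 : ℝ) 1,
      |F (z₀.1 + s * a t, z₀.2 + s * b t) - F z₀
        - s * (partialV F z₀ * a t + partialR F z₀ * b t)| ≤ η * s := by
  obtain ⟨Ca, hCa0, hCa⟩ := exists_forall_abs_le ha
  obtain ⟨Cb, hCb0, hCb⟩ := exists_forall_abs_le hb
  have hC : 0 < Ca + Cb + 1 := by positivity
  have hlo := hF.hasFDerivAt.isLittleO.def (div_pos hη hC)
  filter_upwards [(eventually_forall_deformed hlo ha hb).filter_mono nhdsWithin_le_nhds,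
    self_mem_nhdsWithin] with s hs hs0 t ht
  have hs0' : 0 < s := hs0
  have h := hs t ht
  have hsub : ((z₀.1 + s * a t, z₀.2 + s * b t) : ℝ × ℝ) - z₀ = (s * a t, s * b t) := by
    ext <;> simp
  have hnorm : ‖((s * a t, s * b t) : ℝ × ℝ)‖ ≤ s * (Ca + Cb + 1) := by
    rw [Prod.norm_def, Real.norm_eq_abs, Real.norm_eq_abs, abs_mul, abs_mul, abs_of_pos hs0']
    have h1 := hCa t ht
    have h2 := hCb t ht
    exact max_le (by nlinarith) (by nlinarith)
  rw [hsub, fderiv_eq_partials, Real.norm_eq_abs] at h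
  calc |F (z₀.1 + s * a t, z₀.2 + s * b t) - F z₀
        - s * (partialV F z₀ * a t + partialR F z₀ * b t)|
      = |F (z₀.1 + s * a t, z₀.2 + s * b t) - F z₀
        - (partialV F z₀ * (s * a t) + partialR F z₀ * (s * b t))| := by congr 1; ring
    _ ≤ η / (Ca + Cb + 1) * ‖((s * a t, s * b t) : ℝ × ℝ)‖ := h
    _ ≤ η / (Ca + Cb + 1) * (s * (Ca + Cb + 1)) := by gcongr
    _ = η * s := by field_simp

/-- The undeformed sphere lies over `(v₀, r₀)`; deformations stay in open sets containing it. -/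
lemma eventually_forall_graphSphere_mem (n : S2) {K : Set S2} (hK : IsCompact K) {O : Set Pt}
    (hO : IsOpen O) {v₀ r₀ : ℝ} {a b : ℝ → ℝ}
    (ha : ContinuousOn a (Set.Icc (-1 : ℝ) 1)) (hb : ContinuousOn b (Set.Icc (-1 : ℝ) 1))
    (h : ∀ q ∈ K, (Fin.cons v₀ fun j => r₀ * (q : EuclideanSpace ℝ (Fin 3)) j : Pt) ∈ O) :
    ∀ᶠ s in nhds (0 : ℝ), ∀ q ∈ K,
      graphSphere n (fun t => v₀ + s * a t) (fun t => r₀ + s * b t) q ∈ O := by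
  have hcomp {f : ℝ → ℝ} (hf : ContinuousOn f (Set.Icc (-1 : ℝ) 1)) :
      Continuous fun q : S2 => f (height n q) :=
    hf.comp_continuous (continuous_height n) fun q => height_mem_Icc n q
  have ha' := hcomp ha
  have hb' := hcomp hb
  have hcont : Continuous fun z : ℝ × S2 =>
      graphSphere n (fun t => v₀ + z.1 * a t) (fun t => r₀ + z.1 * b t) z.2 := by
    refine continuous_pi fun μ => ?_
    refine Fin.cases ?_ (fun j => ?_) μ
    · exact continuous_const.add (continuous_fst.mul (ha'.comp continuous_snd))
    · refine (continuous_const.add (continuous_fst.mul (hb'.comp continuous_snd))).mul ?_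
      fun_prop
  refine hK.eventually_forall_of_forall_eventually fun q hq => ?_
  refine hcont.continuousAt.eventually_mem (hO.mem_nhds ?_)
  have := h q hq
  simpa [graphSphere] using this

/-! ### Trapped deformations of a marginally trapped round sphere -/

namespace SphericalSpacetime

variable {M : SphericalSpacetime}

/-- The function `r - 2m`, whose sign distinguishes the two sides of the apparent horizon. -/
def excess (M : SphericalSpacetime) (z : ℝ × ℝ) : ℝ := z.2 - 2 * M.m z

lemma differentiableAt_m {z : ℝ × ℝ} (hz : z ∈ M.dom) : DifferentiableAt ℝ M.m z :=
  (contDiffAt_m hz).differentiableAt (by norm_num)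

lemma differentiableAt_excess {z : ℝ × ℝ} (hz : z ∈ M.dom) : DifferentiableAt ℝ M.excess z :=
  differentiableAt_snd.sub ((differentiableAt_m hz).const_mul 2)

lemma partialV_excess {z : ℝ × ℝ} (hz : z ∈ M.dom) :
    partialV M.excess z = -2 * partialV M.m z := by
  have h : fderiv ℝ M.excess z = ContinuousLinearMap.snd ℝ ℝ ℝ - (2 : ℝ) • fderiv ℝ M.m z :=
    (hasFDerivAt_snd.sub ((differentiableAt_m hz).hasFDerivAt.const_mul 2)).fderiv
  rw [partialV, h]
  simp [partialV]

lemma warp_mul {z : ℝ × ℝ} (hz : z ∈ M.dom) : M.warp z * z.2 = M.excess z := by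
  have := (M.pos_of_mem z hz).ne'
  rw [warp, excess]
  field_simp

/-- A small deformation `v = v₀ + s a`, `r = r₀ + s b` of a marginally trapped round sphere is
trapped as soon as `r - 2m` grows, to first order in `s`, more slowly than the Laplacian of `b`. -/
lemma eventually_isTrappedPoint {z₀ : ℝ × ℝ} (hz₀ : z₀ ∈ M.dom) (hAH : M.excess z₀ = 0) (n : S2)
    {a b : ℝ → ℝ} (ha : ∀ t ∈ Set.Icc (-1 : ℝ) 1, ContDiffAt ℝ 3 a t)
    (hb : ∀ t ∈ Set.Icc (-1 : ℝ) 1, ContDiffAt ℝ 3 b t) {η : ℝ} (hη : 0 < η)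
    (hfirst : ∀ t ∈ Set.Icc (-1 : ℝ) 1, partialV M.excess z₀ * a t + partialR M.excess z₀ * b t
      - (deriv (deriv b) t * (1 - t ^ 2) - 2 * deriv b t * t) ≤ -(2 * η)) :
    ∀ᶠ s in nhdsWithin (0 : ℝ) (Set.Ioi 0), ∀ q : S2,
      M.IsTrappedPoint (graphSphere n (fun t => z₀.1 + s * a t) fun t => z₀.2 + s * b t) q ∧
      (z₀.2 + s * b (height n q)) ^ 4 / 2 < (M.metric.firstForm
        (graphSphere n (fun t => z₀.1 + s * a t) fun t => z₀.2 + s * b t) q).det ∧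
      (M.metric.firstForm
        (graphSphere n (fun t => z₀.1 + s * a t) fun t => z₀.2 + s * b t) q).det
        < 2 * (z₀.2 + s * b (height n q)) ^ 4 := by
  have hr₀ := M.pos_of_mem z₀ hz₀
  have hcont {f : ℝ → ℝ} {k : WithTop ℕ∞} (hf : ∀ t ∈ Set.Icc (-1 : ℝ) 1, ContDiffAt ℝ k f t) :
      ContinuousOn f (Set.Icc (-1 : ℝ) 1) := fun t ht => (hf t ht).continuousAt.continuousWithinAt
  have hd1 {f : ℝ → ℝ} (hf : ∀ t ∈ Set.Icc (-1 : ℝ) 1, ContDiffAt ℝ 3 f t) :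
      ∀ t ∈ Set.Icc (-1 : ℝ) 1, ContDiffAt ℝ 2 (deriv f) t :=
    fun t ht => contDiffAt_deriv (hf t ht) (by norm_num)
  have hd2 {f : ℝ → ℝ} (hf : ∀ t ∈ Set.Icc (-1 : ℝ) 1, ContDiffAt ℝ 3 f t) :
      ∀ t ∈ Set.Icc (-1 : ℝ) 1, ContDiffAt ℝ 1 (deriv (deriv f)) t :=
    fun t ht => contDiffAt_deriv (hd1 hf t ht) (by norm_num)
  obtain ⟨Ca, hCa0, hCa⟩ := exists_forall_abs_le (hcont ha)
  obtain ⟨Cb, hCb0, hCb⟩ := exists_forall_abs_le (hcont hb)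
  obtain ⟨Ca1, hCa10, hCa1⟩ := exists_forall_abs_le (hcont (hd1 ha))
  obtain ⟨Ca2, hCa20, hCa2⟩ := exists_forall_abs_le (hcont (hd2 ha))
  obtain ⟨Cb1, hCb10, hCb1⟩ := exists_forall_abs_le (hcont (hd1 hb))
  obtain ⟨Cb2, hCb20, hCb2⟩ := exists_forall_abs_le (hcont (hd2 hb))
  -- the coefficients of the metric are bounded near `z₀`
  have hbdd {f : ℝ × ℝ → ℝ} (hf : ContinuousAt f z₀) : ∀ᶠ z in nhds z₀, |f z| < |f z₀| + 1 :=
    hf.abs.eventually_lt_const (lt_add_one _)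
  have cE : ContinuousAt (fun z => Real.exp (M.β z)) z₀ := (contDiffAt_exp_β hz₀).continuousAt
  have cR : ContinuousAt (fun z : ℝ × ℝ => z.2) z₀ := continuousAt_snd
  set E₀ := Real.exp (M.β z₀) with hE₀
  have hE₀pos : 0 < E₀ := Real.exp_pos _
  have eE := hbdd cE
  have eEi : ∀ᶠ z in nhds z₀, |(Real.exp (M.β z))⁻¹| < |(Real.exp (M.β z₀))⁻¹| + 1 :=
    hbdd (cE.inv₀ (Real.exp_pos _).ne')
  have eR := hbdd cR
  have eRi : ∀ᶠ z : ℝ × ℝ in nhds z₀, |z.2⁻¹| < |z₀.2⁻¹| + 1 := hbdd (cR.inv₀ hr₀.ne')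
  have eG := hbdd (contDiffAt_coefG hz₀).continuousAt
  have eA := hbdd (contDiffAt_coefA hz₀).continuousAt
  have eQ := hbdd (contDiffAt_coefQ hz₀).continuousAt
  have ebr := hbdd (contDiffAt_partialR (contDiffAt_β hz₀)).continuousAt
  have eElow : ∀ᶠ z in nhds z₀, E₀ / 2 < Real.exp (M.β z) :=
    cE.eventually_const_lt (half_lt_self hE₀pos)
  have eRlow : ∀ᶠ z in nhds z₀, z₀.2 / 2 < z.2 := cR.eventually_const_lt (half_lt_self hr₀)
  have edom : ∀ᶠ z in nhds z₀, z ∈ M.dom := M.isOpen_dom.mem_nhds hz₀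
  have hN := edom.and (eE.and (eEi.and (eR.and (eRi.and (eG.and (eA.and (eQ.and (ebr.and
    (eElow.and eRlow)))))))))
  set KE := |Real.exp (M.β z₀)| + 1 with hKE
  set KEi := |(Real.exp (M.β z₀))⁻¹| + 1 with hKEi
  set KR := |z₀.2| + 1 with hKR
  set KRi := |z₀.2⁻¹| + 1 with hKRi
  set KG := |M.coefG z₀| + 1 with hKG
  set KA := |M.coefA z₀| + 1 with hKA
  set KQ := |M.coefQ z₀| + 1 with hKQ
  set Kbr := |partialR M.β z₀| + 1 with hKbr
  have pE : 0 ≤ KE := by positivity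
  have pEi : 0 ≤ KEi := by positivity
  have pR : 0 ≤ KR := by positivity
  have pRi : 0 ≤ KRi := by positivity
  have pG : 0 ≤ KG := by positivity
  have pA : 0 ≤ KA := by positivity
  have pQ : 0 ≤ KQ := by positivity
  have pbr : 0 ≤ Kbr := by positivity
  set Kφ := (|partialV M.excess z₀| * Ca + |partialR M.excess z₀| * Cb + η) * KRi with hKφ
  have pφ : 0 ≤ Kφ := by positivity
  set C := KE + KEi + KR + KRi + KG + KA + KQ + Kbr + Kφ + Ca1 + Ca2 + Cb1 + Cb2 with hC
  have hρ : 0 < min (E₀ / 2) (z₀.2 / 2) := lt_min (half_pos hE₀pos) (half_pos hr₀)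
  filter_upwards [(eventually_forall_deformed hN (hcont ha) (hcont hb)).filter_mono
      nhdsWithin_le_nhds,
    eventually_forall_first_order (differentiableAt_excess hz₀) (hcont ha) (hcont hb) hη,
    (GraphData.eventually_isTrappedAt (C := C) hρ hη).filter_mono nhdsWithin_le_nhds,
    self_mem_nhdsWithin] with s hN hexp htrap hs q
  have hs0 : 0 < s := hs
  have ht : height n q ∈ Set.Icc (-1 : ℝ) 1 := height_mem_Icc n q
  obtain ⟨hdom, bE, bEi, bR, bRi, bG, bA, bQ, bbr, lE, lR⟩ := hN _ ht
  have hexp := hexp _ ht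
  have hfirst := hfirst _ ht
  obtain ⟨U, ν, hν, hG⟩ := exists_isGraphAt n q hs0 ((ha _ ht).of_le (by norm_num))
    ((hb _ ht).of_le (by norm_num)) hdom
  set t := height n q
  set z : ℝ × ℝ := (z₀.1 + s * a t, z₀.2 + s * b t) with hz
  have hwarp : M.warp z * z.2 = M.excess z := warp_mul hdom
  have hz2 : 0 < z.2 := M.pos_of_mem _ hdom
  rw [hAH, sub_zero] at hexp
  obtain ⟨hx1, hx2⟩ := abs_le.mp hexp
  have hφR : M.warp z / s * z.2 = M.excess z / s := by rw [div_mul_eq_mul_div, hwarp]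
  have hφR1 : M.excess z / s ≤ partialV M.excess z₀ * a t + partialR M.excess z₀ * b t + η := by
    rw [div_le_iff₀ hs0]; linarith
  have hφR2 : partialV M.excess z₀ * a t + partialR M.excess z₀ * b t - η ≤ M.excess z / s := by
    rw [le_div_iff₀ hs0]; linarith
  have hlin : |partialV M.excess z₀ * a t + partialR M.excess z₀ * b t|
      ≤ |partialV M.excess z₀| * Ca + |partialR M.excess z₀| * Cb := by
    refine (abs_add_le _ _).trans ?_
    rw [abs_mul, abs_mul]
    gcongr
    · exact hCa t ht
    · exact hCb t ht
  have hφ : |M.warp z / s| ≤ Kφ := by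
    have h1 : M.warp z / s = M.excess z / s * z.2⁻¹ := by rw [← hφR]; field_simp
    rw [h1, abs_mul, hKφ]
    refine mul_le_mul ?_ bRi.le (abs_nonneg _) (by positivity)
    obtain ⟨hl1, hl2⟩ := abs_le.mp hlin
    rw [abs_le]
    constructor <;> linarith
  have hadm : (M.graphData s z.1 z.2 (deriv a t) (deriv (deriv a) t) (deriv b t)
      (deriv (deriv b) t) t ν).Admissible C (min (E₀ / 2) (z₀.2 / 2)) η := by
    refine ⟨hφ.trans ?_, bE.le.trans ?_, bEi.le.trans ?_, bR.le.trans ?_, bRi.le.trans ?_,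
      bG.le.trans ?_, bA.le.trans ?_, bQ.le.trans ?_, bbr.le.trans ?_, (hCa1 t ht).trans ?_,
      (hCa2 t ht).trans ?_, (hCb1 t ht).trans ?_, (hCb2 t ht).trans ?_, abs_le.mpr ht, hν,
      (min_le_left _ _).trans lE.le, (min_le_right _ _).trans lR.le,
      mul_inv_cancel₀ (Real.exp_pos _).ne', mul_inv_cancel₀ hz2.ne', ?_⟩
    iterate 13 linarith
    change M.warp z / s * z.2 - (deriv (deriv b) t * (1 - t ^ 2) - 2 * deriv b t * t) ≤ -η
    rw [hφR]
    linarith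
  obtain ⟨μ, μ', hμ⟩ := htrap _ hadm
  refine ⟨hG.isTrappedPoint hs0 hμ, ?_, ?_⟩
  · rw [hG.det_firstForm]; exact hμ.det_ge
  · rw [hG.det_firstForm]; exact hμ.det_le

lemma vr_graphSphere (n q : S2) {V R : ℝ → ℝ} (h : 0 ≤ R (height n q)) :
    vr (graphSphere n V R q) = (V (height n q), R (height n q)) := vr_cons h q

lemma graphSphere_injective (n : S2) {V R : ℝ → ℝ} (h : ∀ q, 0 < R (height n q)) :
    Function.Injective (graphSphere n V R) := by
  intro q q' hqq
  have hR : R (height n q) = R (height n q') := by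
    have := congrArg vr hqq
    rw [vr_graphSphere n q (h q).le, vr_graphSphere n q' (h q').le] at this
    exact (Prod.mk.inj this).2
  ext j
  have hj : R (height n q) * (q : EuclideanSpace ℝ (Fin 3)) j
      = R (height n q') * (q' : EuclideanSpace ℝ (Fin 3)) j := congrFun hqq j.succ
  rw [← hR] at hj
  exact mul_left_cancel₀ (h q).ne' hj

lemma exists_direction {p : Pt} (hp : 0 < areaRadius p) :
    ∃ n : S2, p = Fin.cons (p 0) fun j => areaRadius p * (n : EuclideanSpace ℝ (Fin 3)) j := by
  have hsq := areaRadius_sq p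
  refine ⟨⟨WithLp.toLp 2 fun j => p j.succ / areaRadius p, ?_⟩, ?_⟩
  · rw [mem_sphere_zero_iff_norm, ← sq_eq_sq₀ (norm_nonneg _) zero_le_one,
      EuclideanSpace.real_norm_sq_eq, Fin.sum_univ_three]
    simp only [Fin.succ_zero_eq_one, Fin.succ_one_eq_two,
      show (2 : Fin 3).succ = (3 : Fin 4) from rfl]
    field_simp
    linarith
  · funext μ
    refine Fin.cases rfl (fun j => ?_) μ
    simp only [Fin.cons_succ]
    field_simp

end SphericalSpacetime

end

open SphericalSpacetime

theorem mainTheorem5 (M : SphericalSpacetime) (p : Pt) (hp : p ∈ M.AH \ M.AHiso)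
    (W : Set Pt) (hW : IsOpen W) (hpW : roundSphere p ⊆ W)
    (U : Set Pt) (hU : IsOpen U) (hpU : p ∈ U)
    (ε : ℝ) (hε : 0 < ε) :
    ∃ Φ : S2 → Pt, M.IsFTrappedSphere Φ ∧
      Set.range Φ ⊆ W ∧
      (Set.range Φ ∩ M.regionR0).Nonempty ∧
      (Set.range Φ \ M.regionR).Nonempty ∧
      Set.range Φ ∩ M.AH ⊆ M.AH \ M.AHiso ∧
      Set.range Φ \ M.regionR ⊆ U ∧
      M.metric.area Φ (M.regionRᶜ) <
        ENNReal.ofReal ε * M.metric.area Φ Set.univ := by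
  obtain ⟨hpAH, hpiso⟩ := hp
  rw [mem_AHiso_iff hpAH] at hpiso
  obtain ⟨hpc, hp0⟩ := hpAH
  have hr₀ : 0 < areaRadius p := areaRadius_pos hpc
  obtain ⟨n, hn⟩ := exists_direction hr₀
  set z₀ := vr p with hz₀def
  have hz₀ : z₀ ∈ M.dom := hpc
  have hz₀2 : 0 < z₀.2 := hr₀
  have hn' : p = Fin.cons z₀.1 fun j => z₀.2 * (n : EuclideanSpace ℝ (Fin 3)) j := hn
  have hAH : M.excess z₀ = 0 := hp0
  -- a cap around the direction of `p` over which the round sphere lies in `U`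
  obtain ⟨δ, hδ, hδ1, hcapU, hcap⟩ := exists_cap n
    (O := {q | (Fin.cons z₀.1 fun j => z₀.2 * (q : EuclideanSpace ℝ (Fin 3)) j : Pt) ∈ U})
    (κ := ENNReal.ofReal (ε / 64) * sphereArea Set.univ) (by
      have hc : Continuous fun q : S2 =>
          (Fin.cons z₀.1 fun j => z₀.2 * (q : EuclideanSpace ℝ (Fin 3)) j : Pt) := by
        refine continuous_pi fun μ => ?_
        refine Fin.cases continuous_const (fun j => ?_) μ
        exact continuous_const.mul (by fun_prop)
      exact hc.continuousAt.eventually_mem (hU.mem_nhds (by rw [← hn']; exact hpU)))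
    (mul_ne_zero (by simpa using hε) sphereArea_univ_ne_zero)
  obtain ⟨b, u, hb, hu, hLap, hulow, hu1⟩ := exists_profile hδ
  have hmv : -2 * partialV M.m z₀ ≠ 0 := mul_ne_zero (by norm_num) hpiso
  -- with this `a`, the first-order change of `r - 2m` is `u - 1/4`
  obtain ⟨a, ha⟩ : ∃ a : ℝ → ℝ,
      a = fun t => (u t - 1 / 4 - partialR M.excess z₀ * b t) / (-2 * partialV M.m z₀) := ⟨_, rfl⟩
  have hac : ∀ t ∈ Set.Icc (-1 : ℝ) 1, ContDiffAt ℝ 3 a t := fun t ht => by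
    rw [ha]
    exact (((hu t ht.2).sub contDiffAt_const).sub (contDiffAt_const.mul (hb t ht.2))).div_const _
  have hbc : ∀ t ∈ Set.Icc (-1 : ℝ) 1, ContDiffAt ℝ 3 b t := fun t ht => hb t ht.2
  have hac0 : ContinuousOn a (Set.Icc (-1 : ℝ) 1) :=
    fun t ht => (hac t ht).continuousAt.continuousWithinAt
  have hbc0 : ContinuousOn b (Set.Icc (-1 : ℝ) 1) :=
    fun t ht => (hbc t ht).continuousAt.continuousWithinAt
  have hfirst (t : ℝ) : partialV M.excess z₀ * a t + partialR M.excess z₀ * b t = u t - 1 / 4 := by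
    rw [partialV_excess hz₀, ha]
    simp only []
    rw [mul_div_cancel₀ _ hmv]
    ring
  -- off the cap `u - 1/4 ≥ 1/4`, so an error of `1/8` leaves the sign of `r - 2m` unaffected there
  have e1 := eventually_isTrappedPoint hz₀ hAH n hac hbc (η := 1 / 8) (by norm_num)
    (fun t ht => by rw [hfirst, hLap t ht.2]; linarith)
  have e2 := eventually_forall_first_order (differentiableAt_excess hz₀) hac0 hbc0
    (η := 1 / 8) (by norm_num)
  have hN : ∀ᶠ z in nhds z₀, z ∈ M.dom ∧ partialV M.m z ≠ 0 ∧ z₀.2 / 2 < z.2 ∧ z.2 < 2 * z₀.2 :=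
    Filter.Eventually.and (M.isOpen_dom.mem_nhds hz₀)
      (((contDiffAt_partialV (contDiffAt_m hz₀)).continuousAt.eventually_ne hpiso).and
        ((continuousAt_snd.eventually_const_lt (half_lt_self hz₀2)).and
          (continuousAt_snd.eventually_lt_const (by linarith))))
  have e3 := eventually_forall_deformed hN hac0 hbc0
  have e4 := eventually_forall_graphSphere_mem n isCompact_univ hW (v₀ := z₀.1) (r₀ := z₀.2)
    hac0 hbc0 (fun q _ => hpW (by rw [roundSphere, Set.mem_ofPred_eq, vr_cons hz₀2.le]))
  have hcapc : IsCompact {q : S2 | 1 - δ ≤ height n q} :=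
    (isClosed_le continuous_const (continuous_height n)).isCompact
  have e5 := eventually_forall_graphSphere_mem n hcapc hU (v₀ := z₀.1) (r₀ := z₀.2)
    hac0 hbc0 (fun q hq => hcapU hq)
  obtain ⟨s, ⟨h1, h2⟩, h3, h4, h5, hs⟩ := ((e1.and e2).and
    ((e3.filter_mono nhdsWithin_le_nhds).and ((e4.filter_mono nhdsWithin_le_nhds).and
      ((e5.filter_mono nhdsWithin_le_nhds).and self_mem_nhdsWithin)))).exists
  have hs0 : 0 < s := hs
  set Φ := graphSphere n (fun t => z₀.1 + s * a t) fun t => z₀.2 + s * b t with hΦ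
  have ht (q : S2) : height n q ∈ Set.Icc (-1 : ℝ) 1 := height_mem_Icc n q
  have hvr (q : S2) : vr (Φ q) = (z₀.1 + s * a (height n q), z₀.2 + s * b (height n q)) :=
    vr_graphSphere n q (M.pos_of_mem _ (h3 _ (ht q)).1).le
  have hcar (q : S2) : Φ q ∈ M.carrier := by
    rw [carrier, Set.mem_ofPred_eq, hvr]; exact (h3 _ (ht q)).1
  have hexc (q : S2) : areaRadius (Φ q) - 2 * M.m (vr (Φ q)) = M.excess (vr (Φ q)) := rfl
  have hexp (q : S2) : |M.excess (vr (Φ q)) - s * (u (height n q) - 1 / 4)| ≤ 1 / 8 * s := by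
    have := h2 _ (ht q)
    rwa [hfirst, hAH, sub_zero, ← hvr] at this
  have hout (q : S2) (hq : ¬ 1 - δ ≤ height n q) : 0 < M.excess (vr (Φ q)) := by
    have hul := hulow _ (not_le.mp hq).le
    have := (abs_le.mp (hexp q)).1
    nlinarith
  have hin {q : S2} (hq : Φ q ∉ M.regionR) : 1 - δ ≤ height n q := by
    by_contra hlt
    exact hq ⟨hcar q, by rw [hexc]; exact (hout q hlt).le⟩
  refine ⟨Φ, ?_, ?_, ?_, ?_, ?_, ?_, ?_⟩
  · exact {
      contMDiff := contMDiff_graphSphere n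
        (fun t ht => contDiffAt_const.add (contDiffAt_const.mul (hac t ht)))
        (fun t ht => contDiffAt_const.add (contDiffAt_const.mul (hbc t ht)))
      injective := graphSphere_injective n fun q => M.pos_of_mem _ (h3 _ (ht q)).1
      mem_carrier := hcar
      spacelike := fun q => (h1 q).1.spacelike
      trapped := fun q => (h1 q).1.trapped }
  · rintro _ ⟨q, rfl⟩
    exact h4 q (Set.mem_univ q)
  · refine ⟨Φ (-n), ⟨-n, rfl⟩, hcar _, ?_⟩
    rw [hexc]
    refine hout _ ?_
    rw [height_neg_self]
    linarith
  · refine ⟨Φ n, ⟨n, rfl⟩, fun h => ?_⟩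
    have h6 : 0 ≤ M.excess (vr (Φ n)) := h.2
    have h7 := (abs_le.mp (hexp n)).2
    rw [height_self] at h7
    nlinarith
  · rintro _ ⟨⟨q, rfl⟩, hq⟩
    refine ⟨hq, ?_⟩
    rw [mem_AHiso_iff hq, hvr]
    exact (h3 _ (ht q)).2.1
  · rintro _ ⟨⟨q, rfl⟩, hq⟩
    exact h5 q (hin hq)
  · have hdens (q : S2) : z₀.2 ^ 2 / 8 ≤ Real.sqrt ((M.metric.firstForm Φ q).det / roundGram q) ∧
        Real.sqrt ((M.metric.firstForm Φ q).det / roundGram q) ≤ 8 * z₀.2 ^ 2 := by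
      obtain ⟨-, hl, hu⟩ := h1 q
      obtain ⟨-, -, hr1, hr2⟩ := h3 _ (ht q)
      simp only at hr1 hr2
      rw [roundGram_eq_one, div_one]
      have hp1 : (z₀.2 / 2) ^ 4 ≤ (z₀.2 + s * b (height n q)) ^ 4 :=
        pow_le_pow_left₀ (by positivity) hr1.le 4
      have hp2 : (z₀.2 + s * b (height n q)) ^ 4 ≤ (2 * z₀.2) ^ 4 :=
        pow_le_pow_left₀ (by linarith) hr2.le 4
      have hp3 : 0 < z₀.2 ^ 4 := by positivity
      constructor
      · refine Real.le_sqrt_of_sq_le ?_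
        nlinarith
      · refine Real.sqrt_le_iff.mpr ⟨by positivity, ?_⟩
        nlinarith
    have hupper : M.metric.area Φ M.regionRᶜ
        ≤ ENNReal.ofReal (8 * z₀.2 ^ 2) * sphereArea {q | 1 - δ ≤ height n q} := by
      rw [MetricField.area]
      calc _ ≤ ∫⁻ q in {q | 1 - δ ≤ height n q}, ENNReal.ofReal (Real.sqrt
            ((M.metric.firstForm Φ q).det / roundGram q)) ∂sphereArea :=
            lintegral_mono_set fun q hq => hin hq
        _ ≤ ∫⁻ _ in {q | 1 - δ ≤ height n q}, ENNReal.ofReal (8 * z₀.2 ^ 2) ∂sphereArea :=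
            lintegral_mono fun q => ENNReal.ofReal_le_ofReal (hdens q).2
        _ = _ := setLIntegral_const _ _
    have hlower : ENNReal.ofReal (z₀.2 ^ 2 / 8) * sphereArea Set.univ
        ≤ M.metric.area Φ Set.univ := by
      rw [MetricField.area, Set.preimage_univ]
      calc _ = ∫⁻ _ in Set.univ, ENNReal.ofReal (z₀.2 ^ 2 / 8) ∂sphereArea :=
            (setLIntegral_const _ _).symm
        _ ≤ _ := lintegral_mono fun q => ENNReal.ofReal_le_ofReal (hdens q).1
    have hconst : ENNReal.ofReal (8 * z₀.2 ^ 2) * ENNReal.ofReal (ε / 64)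
        = ENNReal.ofReal ε * ENNReal.ofReal (z₀.2 ^ 2 / 8) := by
      rw [← ENNReal.ofReal_mul (by positivity), ← ENNReal.ofReal_mul hε.le]
      congr 1
      ring
    calc M.metric.area Φ M.regionRᶜ
        ≤ ENNReal.ofReal (8 * z₀.2 ^ 2) * sphereArea {q | 1 - δ ≤ height n q} := hupper
      _ < ENNReal.ofReal (8 * z₀.2 ^ 2) * (ENNReal.ofReal (ε / 64) * sphereArea Set.univ) :=
          ENNReal.mul_lt_mul_right (by simpa using by positivity) ENNReal.ofReal_ne_top hcap
      _ = ENNReal.ofReal ε * (ENNReal.ofReal (z₀.2 ^ 2 / 8) * sphereArea Set.univ) := by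
          rw [← mul_assoc, hconst, mul_assoc]
      _ ≤ ENNReal.ofReal ε * M.metric.area Φ Set.univ := by gcongr
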